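/- Fix $k\in\mathbb N$; letters are bit vectors over $V=\{v_1,\dots,v_k\}$ and words are elements of $\mathcal P(V)^*$. A (succinct) alternating automaton $(B,Q,\Delta,I,F)$ over bit variables $B$ has a finite state set $Q$, Boolean transition formulae $\Delta(q)$ over $B\cup Q$ positive on states, an initial formula $I$ positive on states and a final formula $F$ negative on states; a run $\alpha_0b_1\alpha_1\cdots b_m\alpha_m$ satisfies $b_i\cup\alpha_i\models\bigwedge_{q\in\alpha_{i-1}}\Delta(q)$ and is accepting if $\alpha_0\models I$ and $\alpha_m\models F$. An $n$-track alternating transducer (AFT) is such an automaton over $(V\cup E)\times\{1,\dots,n\}$ with $E$ a finite set of epsilon bits; it accepts $(w_1,\dots,w_n)$ if it accepts a word whose $i$-th track, after erasing the letters in which some epsilon bit is set, is $w_i$, for all $i$. In an AFT with synchronisation parameters, $I$ and $F$ may moreover mention Boolean parameters, with any polarity; parameters are evaluated by an assignment shared by all constraints of a formula. A straight-line conjunction is a conjunction $\psi\wedge\bigwedge_{i=1}^m x_i=P_i$, up to reordering, with $\psi$ a conjunction of regular constraints $\mathcal A(x)$ and negated regular constraints, the $x_i$ pairwise distinct, and each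 $P_i$ either $y_1\circ\cdots\circ y_n$ ($n\ge1$, string variables $y_j$) or $R(y)$ for a parameter-free 2-track AFT $R$, such that $P_i$ contains none of $x_i,\dots,x_m$; $x=R(y)$ means that $R$ accepts $(x,y)$. It is preprocessed if $\psi$ is empty. Mixed constraints $x=R[\bar s](y_1\circ\cdots\circ y_n)$ mean that $R$ with parameters $\bar s$ accepts $(x,\,y_1\circ\cdots\circ y_n)$. Consider: * Substitution step: $x=y_1\circ\cdots\circ y_n\wedge\psi$ becomes $\psi[y_1\circ\cdots\circ y_n/x]$. * Splitting step ($m,n\ge 1$): $x=R[\bar s](y_1\circ\cdots\circ y_m\circ z_1\circ\cdots\circ z_n)\wedge\psi$ becomes $x_1=R_1[\bar s,\bar t](y_1\circ\cdots\circ y_m)\wedge x_2=R_2[\bar s,\bar t](z_1\circ\cdots\circ z_n)\wedge\psi[x_1\circ x_2/x]$, with $x_1,x_2$ distinct fresh variables and one fresh parameter $t_q$ for every state $q$ of $R$; $R_1$ is $R$ with final formula $\bigwedge_q(q\to t_q)$, and $R_2$ is $R$ with initial formula $\bigwedge_q(t_q\to q)$. * Reordering, for a conjunction of constraints $x=R[\bar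 s](y)$: order the conjuncts by their left-hand sides along a topological order of the dependency graph (edges $x\to y$ for conjuncts $x=R[\bar s](y)$; $x$ precedes $y$), and associate the conjunction from the right (the empty conjunction being $\mathtt{true}$). A string formula (a Boolean combination of word equations, regular constraints and rational constraints $R[\bar s](x_1,\dots,x_n)$) is acyclic with synchronisation parameters (ACsp) if it contains no word equation, rational constraints occur only positively and with pairwise distinct variables, and the two sides of every conjunction at a positive position and of every disjunction at a negative position share at most one variable. **Theorem.** (1) Let $\varphi_0$ be a preprocessed straight-line conjunction. Substitution steps from $\varphi_0$ terminate in whatever order they are applied. If $\varphi_1$ is an equation-free conjunction so obtained, splitting steps from $\varphi_1$ terminate in whatever order they are applied, and every concatenation-free conjunction $\varphi_2$ so obtained can be reordered; in particular some result $\varphi_3$ exists. Every $\varphi_3$ obtained from $\varphi_0$ by substitution until no equation is left, then splitting until no concatenation is left, then reordering, is satisfiable if and only if $\varphi_0$ is, and is ACsp. (2) Satisfiability of straight-line conjunctions over $\mathcal P(V)$ is decidable: there is a computable function that, given the code of a straight-line conjunction (with regular and negated regular constraints allowed), decides whether it is satisfiable. -/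

import Mathlib

namespace StringSL

/-! ### Boolean formulae -/

/-- Boolean formulae over a set `A` of atoms. -/
inductive BForm (A : Type) : Type
  | tru : BForm A
  | fls : BForm A
  | atom : A → BForm A
  | neg : BForm A → BForm A
  | and : BForm A → BForm A → BForm A
  | or : BForm A → BForm A → BForm A

namespace BForm

variable {A : Type}

/-- Truth value of a formula under an assignment. -/
def eval (v : A → Bool) : BForm A → Bool
  | tru => true
  | fls => false
  | atom a => v a
  | neg f => !(f.eval v)
  | and f g => f.eval v && g.eval v
  | or f g => f.eval v || g.eval v

/-- `f.OccursAt true a`: the atom `a` occurs in `f` under an even number of negations;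
`f.OccursAt false a`: it occurs under an odd number of negations. -/
def OccursAt : BForm A → Bool → A → Prop
  | tru, _, _ => False
  | fls, _, _ => False
  | atom a', p, a => a = a' ∧ p = true
  | neg f, p, a => f.OccursAt (!p) a
  | and f g, p, a => f.OccursAt p a ∨ g.OccursAt p a
  | or f g, p, a => f.OccursAt p a ∨ g.OccursAt p a

/-- The atom `a` occurs in `f`. -/
def Occurs (f : BForm A) (a : A) : Prop := f.OccursAt true a ∨ f.OccursAt false a

/-- `f` is positive on `a`: every occurrence is under an even number of negations. -/
def PositiveOn (f : BForm A) (a : A) : Prop := ¬ f.OccursAt false a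

/-- `f` is negative on `a`: every occurrence is under an odd number of negations. -/
def NegativeOn (f : BForm A) (a : A) : Prop := ¬ f.OccursAt true a

/-- Conjunction of a finite list of formulae. -/
def conj : List (BForm A) → BForm A
  | [] => tru
  | f :: l => and f (conj l)

/-- Implication. -/
def imp (f g : BForm A) : BForm A := or (neg f) g

theorem occursAt_conj (l : List (BForm A)) (p : Bool) (a : A) :
    (conj l).OccursAt p a ↔ ∃ f ∈ l, f.OccursAt p a := by
  induction l with
  | nil => simp [conj, OccursAt]
  | cons f l ih => simp [conj, OccursAt, ih]

/-- Numerical code of a formula. -/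
def code [Encodable A] : BForm A → ℕ
  | tru => Nat.pair 0 0
  | fls => Nat.pair 1 0
  | atom a => Nat.pair 2 (Encodable.encode a)
  | neg f => Nat.pair 3 f.code
  | and f g => Nat.pair 4 (Nat.pair f.code g.code)
  | or f g => Nat.pair 5 (Nat.pair f.code g.code)

end BForm

/-! ### Succinct alternating automata -/

/-- A succinct alternating finite automaton over the bit variables `B`, whose initial and final
formulae may also mention parameters from `P` (with any polarity). The states are
`0, …, states - 1`. For `P = Empty` this is an ordinary succinct alternating automaton. -/
structure AFA (B P : Type) : Type where
  states : ℕ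
  trans : Fin states → BForm (B ⊕ Fin states)
  init : BForm (Fin states ⊕ P)
  final : BForm (Fin states ⊕ P)
  trans_pos : ∀ q r, (trans q).PositiveOn (Sum.inr r)
  init_pos : ∀ q, init.PositiveOn (Sum.inl q)
  final_neg : ∀ q, final.NegativeOn (Sum.inl q)

namespace AFA

variable {B P : Type}

/-- A configuration is a set of states. -/
abbrev Config (A : AFA B P) : Type := Fin A.states → Bool

/-- One step of a run: reading the bit vector `b` in the configuration `α`, the automaton may pass
to `β` iff `b ∪ β` satisfies the transition formula of every state in `α`. -/
def Step (A : AFA B P) (α : A.Config) (b : B → Bool) (β : A.Config) : Prop :=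
  ∀ q, α q = true → (A.trans q).eval (Sum.elim b β) = true

/-- There is a run over the given word from the first to the second configuration. -/
def Run (A : AFA B P) : A.Config → List (B → Bool) → A.Config → Prop
  | α, [], β => α = β
  | α, b :: w, β => ∃ γ, A.Step α b γ ∧ A.Run γ w β

/-- The word `w` is accepted with the parameter assignment `π`. -/
def Accepts (A : AFA B P) (π : P → Bool) (w : List (B → Bool)) : Prop :=
  ∃ α β, A.Run α w β ∧ A.init.eval (Sum.elim α π) = true ∧ A.final.eval (Sum.elim β π) = true

/-- Numerical code of an automaton. -/
def code [Encodable B] [Encodable P] (A : AFA B P) : ℕ :=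
  Encodable.encode (A.states, List.ofFn (fun q => (A.trans q).code), A.init.code, A.final.code)

end AFA

/-! ### Words and transducers -/

/-- Letters are bit vectors over `k` bit variables. -/
abbrev Letter (k : ℕ) : Type := Fin k → Bool

/-- Words over the alphabet of bit vectors. -/
abbrev Word (k : ℕ) : Type := List (Letter k)

/-- The word obtained by erasing every bit vector in which some epsilon bit is set. -/
def compact {k e : ℕ} (w : List (Fin k ⊕ Fin e → Bool)) : Word k :=
  w.filterMap fun b => if ∃ i : Fin e, b (Sum.inr i) = true then none
    else some fun v => b (Sum.inl v)

/-- Contents of the `i`-th track. -/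
def track {W : Type} {n : ℕ} (i : Fin n) (w : List (W × Fin n → Bool)) : List (W → Bool) :=
  w.map fun b v => b (v, i)

/-- A succinct alternating finite transducer with `n` tracks and synchronisation parameters. It
reads, on every track, the `k` input bits and its `eps` epsilon bits; parameters are named by
natural numbers, and those of the transducer are the ones occurring in its initial or final
formula. -/
structure AFT (k n : ℕ) : Type where
  eps : ℕ
  aut : AFA ((Fin k ⊕ Fin eps) × Fin n) ℕ

namespace AFT

variable {k n : ℕ}

/-- The tuple `x` of words is accepted with the parameter assignment `π`. -/
def Accepts (R : AFT k n) (π : ℕ → Bool) (x : Fin n → Word k) : Prop :=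
  ∃ w, R.aut.Accepts π w ∧ ∀ i, x i = compact (track i w)

/-- The parameter `s` occurs in `R`. -/
def HasParam (R : AFT k n) (s : ℕ) : Prop :=
  R.aut.init.Occurs (Sum.inr s) ∨ R.aut.final.Occurs (Sum.inr s)

/-- `R` is an ordinary transducer, without parameters. -/
def ParamFree (R : AFT k n) : Prop := ∀ s, ¬ R.HasParam s

/-- First half of a split transducer: the final formula becomes `⋀ q, q → t q`. -/
def splitFst (R : AFT k n) (t : Fin R.aut.states → ℕ) : AFT k n where
  eps := R.eps
  aut :=
    { R.aut with
      final := BForm.conj ((List.finRange R.aut.states).map fun q =>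
        BForm.imp (BForm.atom (Sum.inl q)) (BForm.atom (Sum.inr (t q))))
      final_neg := by
        intro q h
        rw [BForm.occursAt_conj] at h
        simp [BForm.imp, BForm.OccursAt] at h }

/-- Second half of a split transducer: the initial formula becomes `⋀ q, t q → q`. -/
def splitSnd (R : AFT k n) (t : Fin R.aut.states → ℕ) : AFT k n where
  eps := R.eps
  aut :=
    { R.aut with
      init := BForm.conj ((List.finRange R.aut.states).map fun q =>
        BForm.imp (BForm.atom (Sum.inr (t q))) (BForm.atom (Sum.inl q)))
      init_pos := by
        intro q h
        rw [BForm.occursAt_conj] at h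
        simp [BForm.imp, BForm.OccursAt] at h }

/-- Numerical code of a transducer. -/
def code (R : AFT k n) : ℕ := Encodable.encode (R.eps, R.aut.code)

end AFT

/-! ### String formulae and the acyclic fragment -/

/-- Terms over string variables (named by natural numbers) and letters. -/
inductive Term (k : ℕ) : Type
  | var : ℕ → Term k
  | letter : Letter k → Term k
  | concat : Term k → Term k → Term k

namespace Term

/-- Value of a term. -/
def eval {k : ℕ} (ι : ℕ → Word k) : Term k → Word k
  | var x => ι x
  | letter a => [a]
  | concat s t => s.eval ι ++ t.eval ι

/-- Variables of a term. -/
def vars {k : ℕ} : Term k → Finset ℕ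
  | var x => {x}
  | letter _ => ∅
  | concat s t => s.vars ∪ t.vars

end Term

/-- String formulae: Boolean combinations of word equations, regular constraints and rational
constraints (with synchronisation parameters); `tru` is the empty conjunction. -/
inductive SForm (k : ℕ) : Type
  | tru : SForm k
  | eq : ℕ → Term k → SForm k
  | reg : AFA (Fin k) Empty → ℕ → SForm k
  | rat : {n : ℕ} → AFT k n → (Fin n → ℕ) → SForm k
  | and : SForm k → SForm k → SForm k
  | or : SForm k → SForm k → SForm k
  | neg : SForm k → SForm k

namespace SForm

variable {k : ℕ}

/-- Satisfaction by an assignment `ι` of the string variables and `π` of the parameters. -/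
def Holds (ι : ℕ → Word k) (π : ℕ → Bool) : SForm k → Prop
  | tru => True
  | eq x t => ι x = t.eval ι
  | reg A x => A.Accepts Empty.elim (ι x)
  | rat R x => R.Accepts π fun i => ι (x i)
  | and φ ψ => φ.Holds ι π ∧ ψ.Holds ι π
  | or φ ψ => φ.Holds ι π ∨ ψ.Holds ι π
  | neg φ => ¬ φ.Holds ι π

/-- The formula has a solution. -/
def Satisfiable (φ : SForm k) : Prop := ∃ ι π, φ.Holds ι π

/-- String variables of a formula. -/
def vars : SForm k → Finset ℕ
  | tru => ∅
  | eq x t => insert x t.vars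
  | reg _ x => {x}
  | rat _ x => Finset.univ.image x
  | and φ ψ => φ.vars ∪ ψ.vars
  | or φ ψ => φ.vars ∪ ψ.vars
  | neg φ => φ.vars

/-- The conditions of acyclicity for a formula standing at a positive (`true`) or negative
(`false`) position. -/
def AcyclicAt : Bool → SForm k → Prop
  | _, tru => True
  | _, eq _ _ => False
  | _, reg _ _ => True
  | p, rat _ x => p = true ∧ Function.Injective x
  | p, and φ ψ => AcyclicAt p φ ∧ AcyclicAt p ψ ∧ (p = true → (φ.vars ∩ ψ.vars).card ≤ 1)
  | p, or φ ψ => AcyclicAt p φ ∧ AcyclicAt p ψ ∧ (p = false → (φ.vars ∩ ψ.vars).card ≤ 1)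
  | p, neg φ => AcyclicAt (!p) φ

/-- Acyclic formulae with synchronisation parameters: no word equations, rational constraints only
positively and with pairwise distinct variables, and the two sides of every positive conjunction
(and of every negative disjunction) share at most one variable. -/
def Acyclic (φ : SForm k) : Prop := φ.AcyclicAt true

end SForm

/-! ### Straight-line conjunctions -/

/-- The conjuncts `x = y₁ ∘ ⋯ ∘ yₙ` and `x = R[s](y₁ ∘ ⋯ ∘ yₙ)`. -/
inductive Conjunct (k : ℕ) : Type
  | eqn : ℕ → List ℕ → Conjunct k
  | rat : ℕ → AFT k 2 → List ℕ → Conjunct k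

namespace Conjunct

variable {k : ℕ}

/-- The variable on the left-hand side. -/
def lhs : Conjunct k → ℕ
  | eqn x _ => x
  | rat x _ _ => x

/-- The sequence of variables concatenated on the right-hand side. -/
def rhs : Conjunct k → List ℕ
  | eqn _ ys => ys
  | rat _ _ ys => ys

/-- Satisfaction; the left-hand side is read on the first track. -/
def Holds (ι : ℕ → Word k) (π : ℕ → Bool) : Conjunct k → Prop
  | eqn x ys => ι x = ys.flatMap ι
  | rat x R ys => R.Accepts π ![ι x, ys.flatMap ι]

/-- The parameter `s` occurs in the conjunct. -/
def HasParam : Conjunct k → ℕ → Prop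
  | eqn _ _, _ => False
  | rat _ R _, s => R.HasParam s

/-- The variable `z` occurs in the conjunct. -/
def HasVar (c : Conjunct k) (z : ℕ) : Prop := z = c.lhs ∨ z ∈ c.rhs

/-- Replace in a sequence every occurrence of `x` by the sequence `us`. -/
def replaceVar (x : ℕ) (us ys : List ℕ) : List ℕ := ys.flatMap fun y => if y = x then us else [y]

/-- Replace every occurrence of `x` on the right-hand side by the concatenation of `us`. (When this
is used, `x` is the left-hand side of a removed conjunct, hence of no other one.) -/
def subst (x : ℕ) (us : List ℕ) : Conjunct k → Conjunct k
  | eqn z ys => eqn z (replaceVar x us ys)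
  | rat z R ys => rat z R (replaceVar x us ys)

/-- The conjunct is not an equation. -/
def IsRational : Conjunct k → Prop
  | eqn _ _ => False
  | rat _ _ _ => True

/-- Numerical code of a conjunct. -/
def code : Conjunct k → ℕ
  | eqn x ys => Nat.pair 0 (Encodable.encode (x, ys))
  | rat x R ys => Nat.pair 1 (Encodable.encode (x, R.code, ys))

end Conjunct

/-- Conjunctions of such conjuncts; the order of a list carries no meaning. -/
abbrev Conj (k : ℕ) : Type := List (Conjunct k)

namespace Conj

variable {k : ℕ}

/-- Satisfaction of all conjuncts. -/
def Holds (ι : ℕ → Word k) (π : ℕ → Bool) (φ : Conj k) : Prop := ∀ c ∈ φ, c.Holds ι π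

/-- The conjunction has a solution. -/
def Satisfiable (φ : Conj k) : Prop := ∃ ι π, Holds ι π φ

/-- Generalised straight-line conjunctions: the conjuncts can be ordered as `x₁ = F₁, …, xₘ = Fₘ`
with pairwise distinct `x₁, …, xₘ`, where each `Fᵢ` contains a (non-empty) concatenation in which
none of `xᵢ, …, xₘ` occurs. -/
def IsGenSL (φ : Conj k) : Prop :=
  ∃ l : Conj k, l.Perm φ ∧ (∀ c ∈ l, c.rhs ≠ [] ∧ c.lhs ∉ c.rhs) ∧
    l.Pairwise fun c d => c.lhs ≠ d.lhs ∧ d.lhs ∉ c.rhs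

/-- Straight-line conjunctions of equations `x = y₁ ∘ ⋯ ∘ yₙ` and binary rational constraints
`x = R(y)`, where `R` has no parameters. -/
def IsSL (φ : Conj k) : Prop :=
  IsGenSL φ ∧ ∀ x R ys, Conjunct.rat x R ys ∈ φ → R.ParamFree ∧ ∃ y, ys = [y]

/-! ### The translation -/

/-- One substitution step: `x = y₁ ∘ ⋯ ∘ yₙ ∧ ψ` is replaced by `ψ[y₁ ∘ ⋯ ∘ yₙ / x]`. -/
def SubstStep (φ φ' : Conj k) : Prop :=
  ∃ x ys ψ, φ.Perm (Conjunct.eqn x ys :: ψ) ∧ φ' = ψ.map (Conjunct.subst x ys)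

/-- One binary splitting step: `x = R[s](y₁ ∘ ⋯ ∘ yₘ ∘ z₁ ∘ ⋯ ∘ zₙ) ∧ ψ` is replaced by
`x₁ = R₁[s,t](y₁ ∘ ⋯ ∘ yₘ) ∧ x₂ = R₂[s,t](z₁ ∘ ⋯ ∘ zₙ) ∧ ψ[x₁ ∘ x₂ / x]`, with two fresh string
variables and one fresh parameter for every state of `R`. -/
def SplitStep (φ φ' : Conj k) : Prop :=
  ∃ (x : ℕ) (R : AFT k 2) (ys zs : List ℕ) (ψ : Conj k) (x₁ x₂ : ℕ)
    (t : Fin R.aut.states → ℕ),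
    φ.Perm (Conjunct.rat x R (ys ++ zs) :: ψ) ∧ ys ≠ [] ∧ zs ≠ [] ∧
    x₁ ≠ x₂ ∧ (∀ c ∈ φ, ¬ c.HasVar x₁ ∧ ¬ c.HasVar x₂) ∧
    Function.Injective t ∧ (∀ c ∈ φ, ∀ q, ¬ c.HasParam (t q)) ∧
    φ' = Conjunct.rat x₁ (R.splitFst t) ys :: Conjunct.rat x₂ (R.splitSnd t) zs ::
      ψ.map (Conjunct.subst x [x₁, x₂])

/-- A constraint `x = R[s](y)`, given by `(x, R, y)`, as a string formula. -/
def ratForm (c : ℕ × AFT k 2 × ℕ) : SForm k := SForm.rat c.2.1 ![c.1, c.2.2]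

/-- Conjunction of a list of such constraints, associated from the right. -/
def rightConj : List (ℕ × AFT k 2 × ℕ) → SForm k
  | [] => SForm.tru
  | [c] => ratForm c
  | c :: d :: l => SForm.and (ratForm c) (rightConj (d :: l))

/-- `pos` lists the variables of `φ` in a topological order of the dependency graph, which has an
edge `x ⟶ y` whenever a conjunct `x = R(y)` belongs to `φ`. -/
def IsTopologicalOrder (φ : Conj k) (pos : ℕ → ℕ) : Prop :=
  Set.InjOn pos {z | ∃ c ∈ φ, c.HasVar z} ∧ ∀ c ∈ φ, ∀ y ∈ c.rhs, pos c.lhs < pos y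

/-- `φ₃` arises from the conjunction `φ₂` of rational constraints (without concatenation) by
ordering the conjuncts along a topological order of the dependency graph and associating from the
right. -/
def Reorder (φ₂ : Conj k) (φ₃ : SForm k) : Prop :=
  ∃ (l : List (ℕ × AFT k 2 × ℕ)) (pos : ℕ → ℕ),
    (l.map fun c => Conjunct.rat c.1 c.2.1 [c.2.2]).Perm φ₂ ∧
    IsTopologicalOrder φ₂ pos ∧
    l.Pairwise (fun c d => pos c.1 < pos d.1) ∧
    φ₃ = rightConj l

/-- `φ₁` is obtained from `φ₀` by iterating substitution until no equation is left. -/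
def Substituted (φ₀ φ₁ : Conj k) : Prop :=
  Relation.ReflTransGen SubstStep φ₀ φ₁ ∧ ∀ c ∈ φ₁, c.IsRational

/-- `φ₂` is obtained from `φ₁` by iterating splitting until no concatenation is left. -/
def Splitted (φ₁ φ₂ : Conj k) : Prop :=
  Relation.ReflTransGen SplitStep φ₁ φ₂ ∧ ∀ c ∈ φ₂, c.rhs.length ≤ 1

/-- `φ₃` is obtained from `φ₀` by substitution, splitting and reordering. -/
def Translates (φ₀ : Conj k) (φ₃ : SForm k) : Prop :=
  ∃ φ₁ φ₂, Substituted φ₀ φ₁ ∧ Splitted φ₁ φ₂ ∧ Reorder φ₂ φ₃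

/-- Numerical code of a conjunction. -/
def code (φ : Conj k) : ℕ := Encodable.encode (φ.map Conjunct.code)

end Conj

/-! ### Straight-line conjunctions with regular constraints -/

/-- A regular constraint `A(x)` or, if `neg` is set, a negated one `¬ A(x)`. -/
structure RegLit (k : ℕ) : Type where
  neg : Bool
  aut : AFA (Fin k) Empty
  var : ℕ

namespace RegLit

variable {k : ℕ}

/-- Satisfaction of a possibly negated regular constraint. -/
def Holds (ι : ℕ → Word k) (c : RegLit k) : Prop :=
  if c.neg = true then ¬ c.aut.Accepts Empty.elim (ι c.var)
  else c.aut.Accepts Empty.elim (ι c.var)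

/-- Numerical code of a possibly negated regular constraint. -/
def code (c : RegLit k) : ℕ := Encodable.encode (c.neg, c.aut.code, c.var)

end RegLit

/-- An arbitrary straight-line conjunction `ψ ∧ ⋀ᵢ xᵢ = Pᵢ`, where `ψ` is a conjunction of regular
and negated regular constraints. -/
structure SLConj (k : ℕ) : Type where
  regs : List (RegLit k)
  defs : Conj k
  isSL : Conj.IsSL defs

namespace SLConj

variable {k : ℕ}

/-- The conjunction has a solution. -/
def Satisfiable (φ : SLConj k) : Prop :=
  ∃ ι π, (∀ c ∈ φ.regs, c.Holds ι) ∧ Conj.Holds ι π φ.defs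

/-- Numerical code of a straight-line conjunction. -/
def code (φ : SLConj k) : ℕ :=
  Encodable.encode (φ.regs.map RegLit.code, Conj.code φ.defs)

end SLConj

end StringSL

namespace StringSL

open Function

/-! ### Polarity and evaluation of Boolean formulae -/

namespace BForm

variable {A : Type}

/-- Negation exchanges the two hypotheses, so both polarities have to be carried through the
induction with the assignments generalised. -/
theorem eval_mono (f : BForm A) {v v' : A → Bool}
    (ht : ∀ a, f.OccursAt true a → v a = true → v' a = true)
    (hf : ∀ a, f.OccursAt false a → v' a = true → v a = true) (h : f.eval v = true) :
    f.eval v' = true := by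
  induction f generalizing v v' with
  | tru => rfl
  | fls => simp [eval] at h
  | atom a => exact ht a (by simp [OccursAt]) h
  | neg f ih =>
    simp only [eval, Bool.not_eq_true'] at h ⊢
    by_contra hc
    rw [Bool.not_eq_false] at hc
    rw [ih hf ht hc] at h
    cases h
  | and f g ihf ihg =>
    simp only [eval, Bool.and_eq_true] at h ⊢
    exact ⟨ihf (fun a ha => ht a (.inl ha)) (fun a ha => hf a (.inl ha)) h.1,
      ihg (fun a ha => ht a (.inr ha)) (fun a ha => hf a (.inr ha)) h.2⟩
  | or f g ihf ihg =>
    simp only [eval, Bool.or_eq_true] at h ⊢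
    exact h.imp (ihf (fun a ha => ht a (.inl ha)) (fun a ha => hf a (.inl ha)))
      (ihg (fun a ha => ht a (.inr ha)) (fun a ha => hf a (.inr ha)))

theorem eval_congr (f : BForm A) {v v' : A → Bool} (h : ∀ a, f.Occurs a → v a = v' a) :
    f.eval v = f.eval v' := by
  rw [Bool.eq_iff_iff]
  constructor <;> apply eval_mono <;> intro a ha hv
  · rwa [← h a (.inl ha)]
  · rwa [h a (.inr ha)]
  · rwa [h a (.inl ha)]
  · rwa [← h a (.inr ha)]

theorem finite_occursAt (f : BForm A) (p : Bool) : {a | f.OccursAt p a}.Finite := by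
  induction f generalizing p with
  | tru => simp [OccursAt]
  | fls => simp [OccursAt]
  | atom a => exact (Set.finite_singleton a).subset fun b hb => hb.1
  | neg f ih => exact ih _
  | and f g ihf ihg => exact (ihf p).union (ihg p)
  | or f g ihf ihg => exact (ihf p).union (ihg p)

theorem finite_occurs (f : BForm A) : {a | f.Occurs a}.Finite :=
  (f.finite_occursAt true).union (f.finite_occursAt false)

theorem eval_conj (l : List (BForm A)) (v : A → Bool) :
    (conj l).eval v = true ↔ ∀ f ∈ l, f.eval v = true := by
  induction l with
  | nil => simp [conj, eval]
  | cons f l ih => simp [conj, eval, ih]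

theorem eval_imp (f g : BForm A) (v : A → Bool) :
    (imp f g).eval v = true ↔ (f.eval v = true → g.eval v = true) := by
  simp only [imp, eval, Bool.or_eq_true, Bool.not_eq_true']
  cases f.eval v <;> simp

end BForm

/-! ### Runs of alternating automata -/

namespace AFA

variable {B P : Type}

theorem run_append (A : AFA B P) (α β : A.Config) (u v : List (B → Bool)) :
    A.Run α (u ++ v) β ↔ ∃ γ, A.Run α u γ ∧ A.Run γ v β := by
  induction u generalizing α with
  | nil => simp [Run]
  | cons b u ih =>
    simp only [List.cons_append, Run, ih]
    constructor
    · rintro ⟨γ, h, δ, h1, h2⟩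
      exact ⟨δ, ⟨γ, h, h1⟩, h2⟩
    · rintro ⟨δ, ⟨γ, h, h1⟩, h2⟩
      exact ⟨γ, h, δ, h1, h2⟩

theorem final_antitone (A : AFA B P) {α α' : A.Config} {π : P → Bool}
    (h : ∀ q, α' q = true → α q = true) (hf : A.final.eval (Sum.elim α π) = true) :
    A.final.eval (Sum.elim α' π) = true := by
  refine A.final.eval_mono ?_ ?_ hf
  · rintro (q | p) hq hv
    · exact absurd hq (A.final_neg q)
    · exact hv
  · rintro (q | p) _ hv
    · exact h q hv
    · exact hv

/-- Smaller initial configurations admit at least the same runs to accepting configurations. -/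
theorem exists_run_of_le (A : AFA B P) {α α' β : A.Config} {w : List (B → Bool)} {π : P → Bool}
    (h : ∀ q, α' q = true → α q = true) (hr : A.Run α w β)
    (hf : A.final.eval (Sum.elim β π) = true) :
    ∃ β', A.Run α' w β' ∧ A.final.eval (Sum.elim β' π) = true := by
  cases w with
  -- On the empty word the end configuration shrinks as well, and the final formula is negative on
  -- states. Otherwise the first step only has to satisfy fewer transition formulae and can reach
  -- the same successor.
  | nil =>
    cases hr
    exact ⟨α', rfl, A.final_antitone h hf⟩
  | cons b w =>
    obtain ⟨γ, hs, hr⟩ := hr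
    exact ⟨β, ⟨γ, fun q hq => hs q (h q hq), hr⟩, hf⟩

end AFA

theorem compact_append {k e : ℕ} (u v : List (Fin k ⊕ Fin e → Bool)) :
    compact (u ++ v) = compact u ++ compact v := List.filterMap_append

theorem track_append {W : Type} {n : ℕ} (i : Fin n) (u v : List (W × Fin n → Bool)) :
    track i (u ++ v) = track i u ++ track i v := List.map_append

/-- Erasing letters is a `filterMap`, so a factorisation of its output lifts to one of its input.
The cut is not unique when erased letters sit at the border; any choice will do. -/
theorem exists_split_of_compact_track {k e n : ℕ} (i : Fin n)
    (w : List ((Fin k ⊕ Fin e) × Fin n → Bool)) (u v : Word k)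
    (h : u ++ v = compact (track i w)) :
    ∃ w₁ w₂, w = w₁ ++ w₂ ∧ u = compact (track i w₁) ∧ v = compact (track i w₂) := by
  obtain ⟨a, b, hab, rfl, rfl⟩ := List.filterMap_eq_append_iff.1 h.symm
  obtain ⟨w₁, w₂, rfl, rfl, rfl⟩ := List.map_eq_append_iff.1 hab
  exact ⟨w₁, w₂, rfl, rfl, rfl⟩

/-! ### Cutting and gluing transducer runs -/

namespace AFT

variable {k : ℕ}

theorem Accepts.congr {n : ℕ} {R : AFT k n} {π π' : ℕ → Bool} {x : Fin n → Word k}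
    (h : ∀ s, R.HasParam s → π s = π' s) (ha : R.Accepts π x) : R.Accepts π' x := by
  obtain ⟨w, ⟨α, β, hr, hi, hf⟩, hx⟩ := ha
  refine ⟨w, ⟨α, β, hr, ?_, ?_⟩, hx⟩
  · rw [← hi]
    refine BForm.eval_congr _ ?_
    rintro (q | s) hs
    · rfl
    · exact (h s (.inl hs)).symm
  · rw [← hf]
    refine BForm.eval_congr _ ?_
    rintro (q | s) hs
    · rfl
    · exact (h s (.inr hs)).symm

theorem finite_hasParam {n : ℕ} (R : AFT k n) : {s | R.HasParam s}.Finite :=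
  ((R.aut.init.finite_occurs.preimage Sum.inr_injective.injOn).union
    (R.aut.final.finite_occurs.preimage Sum.inr_injective.injOn))

theorem eval_splitFst_final (R : AFT k 2) (t : Fin R.aut.states → ℕ) (β : R.aut.Config)
    (π : ℕ → Bool) : (R.splitFst t).aut.final.eval (Sum.elim β π) = true ↔
      ∀ q, β q = true → π (t q) = true := by
  simp [splitFst, BForm.eval_conj, BForm.eval_imp, BForm.eval]

theorem eval_splitSnd_init (R : AFT k 2) (t : Fin R.aut.states → ℕ) (α : R.aut.Config)
    (π : ℕ → Bool) : (R.splitSnd t).aut.init.eval (Sum.elim α π) = true ↔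
      ∀ q, π (t q) = true → α q = true := by
  simp [splitSnd, BForm.eval_conj, BForm.eval_imp, BForm.eval]

theorem run_splitFst (R : AFT k 2) (t : Fin R.aut.states → ℕ) (α β : R.aut.Config)
    (w : List ((Fin k ⊕ Fin R.eps) × Fin 2 → Bool)) :
    (R.splitFst t).aut.Run α w β ↔ R.aut.Run α w β := by
  induction w generalizing α with
  | nil => rfl
  | cons b w ih => exact exists_congr fun γ => and_congr Iff.rfl (ih γ)

theorem run_splitSnd (R : AFT k 2) (t : Fin R.aut.states → ℕ) (α β : R.aut.Config)
    (w : List ((Fin k ⊕ Fin R.eps) × Fin 2 → Bool)) :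
    (R.splitSnd t).aut.Run α w β ↔ R.aut.Run α w β := by
  induction w generalizing α with
  | nil => rfl
  | cons b w ih => exact exists_congr fun γ => and_congr Iff.rfl (ih γ)

/-- The set of states given by the parameters lies between the end of the first run and the start of
the second. Hence the second run may be restarted from the smaller configuration in which the first
one ends. -/
theorem accepts_of_split {R : AFT k 2} {t : Fin R.aut.states → ℕ} {π : ℕ → Bool}
    {u₁ u₂ v₁ v₂ : Word k} (h₁ : (R.splitFst t).Accepts π ![u₁, v₁])
    (h₂ : (R.splitSnd t).Accepts π ![u₂, v₂]) : R.Accepts π ![u₁ ++ u₂, v₁ ++ v₂] := by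
  obtain ⟨w₁, ⟨α₁, β₁, hr₁, hi₁, hf₁⟩, hx₁⟩ := h₁
  obtain ⟨w₂, ⟨α₂, β₂, hr₂, hi₂, hf₂⟩, hx₂⟩ := h₂
  change List ((Fin k ⊕ Fin R.eps) × Fin 2 → Bool) at w₁ w₂
  change R.aut.Config at α₁ α₂ β₁ β₂
  have hf₁ := (R.eval_splitFst_final t β₁ π).1 hf₁
  have hi₂ := (R.eval_splitSnd_init t α₂ π).1 hi₂
  have hr₁ := (R.run_splitFst t α₁ β₁ w₁).1 hr₁
  have hr₂ := (R.run_splitSnd t α₂ β₂ w₂).1 hr₂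
  obtain ⟨β, hr, hf⟩ := R.aut.exists_run_of_le (fun q hq => hi₂ q (hf₁ q hq)) hr₂ hf₂
  refine ⟨w₁ ++ w₂, ⟨α₁, β, (R.aut.run_append _ _ _ _).2 ⟨β₁, hr₁, hr⟩, hi₁, hf⟩, ?_⟩
  have hx₁0 := hx₁ 0
  have hx₁1 := hx₁ 1
  have hx₂0 := hx₂ 0
  have hx₂1 := hx₂ 1
  simp only [Matrix.cons_val_zero, Matrix.cons_val_one] at hx₁0 hx₁1 hx₂0 hx₂1
  intro i
  rw [track_append, compact_append]
  fin_cases i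
  · exact congrArg₂ (· ++ ·) hx₁0 hx₂0
  · exact congrArg₂ (· ++ ·) hx₁1 hx₂1

/-- The configuration `γ` at the cut is what the new parameters must record. The assignment `π'`
stays universally quantified so that the caller can extend `π` once, compatibly with all other
conjuncts. -/
theorem exists_split_of_accepts {R : AFT k 2} (t : Fin R.aut.states → ℕ) {π : ℕ → Bool}
    {u v₁ v₂ : Word k} (h : R.Accepts π ![u, v₁ ++ v₂]) :
    ∃ (u₁ u₂ : Word k) (γ : R.aut.Config), u = u₁ ++ u₂ ∧ ∀ π' : ℕ → Bool, (∀ s, R.HasParam s → π s = π' s) →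
      (∀ q, π' (t q) = γ q) →
      (R.splitFst t).Accepts π' ![u₁, v₁] ∧ (R.splitSnd t).Accepts π' ![u₂, v₂] := by
  obtain ⟨w, ⟨α, β, hr, hi, hf⟩, hx⟩ := h
  obtain ⟨w₁, w₂, rfl, h₁, h₂⟩ := exists_split_of_compact_track 1 w v₁ v₂ (hx 1)
  obtain ⟨γ, hr₁, hr₂⟩ := (R.aut.run_append _ _ _ _).1 hr
  refine ⟨compact (track 0 w₁), compact (track 0 w₂), γ, ?_, fun π' hπ hγ => ⟨?_, ?_⟩⟩
  · rw [← compact_append, ← track_append]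
    exact hx 0
  · refine ⟨w₁, ⟨α, γ, (R.run_splitFst t _ _ _).2 hr₁, ?_, ?_⟩, ?_⟩
    · rw [← hi]
      refine BForm.eval_congr _ ?_
      rintro (q | s) hs
      · rfl
      · exact (hπ s (.inl hs)).symm
    · exact (R.eval_splitFst_final t γ π').2 fun q hq => by rw [hγ, hq]
    · intro i
      fin_cases i
      · rfl
      · exact h₁
  · refine ⟨w₂, ⟨γ, β, (R.run_splitSnd t _ _ _).2 hr₂, ?_, ?_⟩, ?_⟩
    · exact (R.eval_splitSnd_init t γ π').2 fun q hq => by rw [← hγ, hq]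
    · rw [← hf]
      refine BForm.eval_congr _ ?_
      rintro (q | s) hs
      · rfl
      · exact (hπ s (.inr hs)).symm
    · intro i
      fin_cases i
      · rfl
      · exact h₂

end AFT

end StringSL

namespace StringSL

open Function

/-! ### Substitution inside a conjunct, and the ranked invariant -/

namespace Conjunct

variable {k : ℕ}

theorem lhs_subst (x : ℕ) (us : List ℕ) (c : Conjunct k) : (c.subst x us).lhs = c.lhs := by
  cases c <;> rfl

theorem rhs_subst (x : ℕ) (us : List ℕ) (c : Conjunct k) :
    (c.subst x us).rhs = replaceVar x us c.rhs := by
  cases c <;> rfl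

theorem isRational_subst (x : ℕ) (us : List ℕ) (c : Conjunct k) :
    (c.subst x us).IsRational ↔ c.IsRational := by
  cases c <;> rfl

theorem mem_replaceVar {x y : ℕ} {us ys : List ℕ} (h : y ∈ replaceVar x us ys) :
    y ∈ ys ∨ x ∈ ys ∧ y ∈ us := by
  obtain ⟨z, hz, hy⟩ := List.mem_flatMap.1 h
  split_ifs at hy with hzx
  · exact .inr ⟨hzx ▸ hz, hy⟩
  · rw [List.mem_singleton] at hy
    exact .inl (hy ▸ hz)

theorem replaceVar_ne_nil {x : ℕ} {us ys : List ℕ} (hu : us ≠ []) (hy : ys ≠ []) :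
    replaceVar x us ys ≠ [] := by
  obtain ⟨y, ys, rfl⟩ := List.exists_cons_of_ne_nil hy
  simp only [replaceVar, List.flatMap_cons]
  split_ifs <;> simp [hu]

theorem flatMap_replaceVar {β : Type} (f : ℕ → List β) (x : ℕ) (us ys : List ℕ) :
    (replaceVar x us ys).flatMap f = ys.flatMap (update f x (us.flatMap f)) := by
  rw [replaceVar, List.flatMap_assoc]
  congr 1
  funext y
  by_cases h : y = x
  · simp [h]
  · simp [h]

theorem sum_map_replaceVar (sz : ℕ → ℕ) {x : ℕ} {us : List ℕ} (h : (us.map sz).sum = sz x)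
    (ys : List ℕ) : ((replaceVar x us ys).map sz).sum = (ys.map sz).sum := by
  induction ys with
  | nil => rfl
  | cons y ys ih =>
    have : replaceVar x us (y :: ys) = (if y = x then us else [y]) ++ replaceVar x us ys := rfl
    rw [this, List.map_append, List.sum_append, ih, List.map_cons, List.sum_cons]
    split_ifs with hy
    · rw [h, hy]
    · simp

/-- Syntactic substitution corresponds to updating the assignment. It acts on right-hand sides only,
which is why `x` must not be the left-hand side. -/
theorem holds_subst {ι : ℕ → Word k} {π : ℕ → Bool} {x : ℕ} {us : List ℕ} {c : Conjunct k}
    (hx : c.lhs ≠ x) :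
    (c.subst x us).Holds ι π ↔ c.Holds (update ι x (us.flatMap ι)) π := by
  cases c with
  | eqn z ys => simp [subst, Holds, flatMap_replaceVar, update_of_ne (show z ≠ x from hx)]
  | rat z R ys => simp [subst, Holds, flatMap_replaceVar, update_of_ne (show z ≠ x from hx)]

theorem flatMap_congr_of_mem {β : Type} {f g : ℕ → List β} {ys : List ℕ}
    (h : ∀ y ∈ ys, f y = g y) : ys.flatMap f = ys.flatMap g := by
  simp only [List.flatMap_def]
  rw [List.map_congr_left h]

theorem Holds.congr {ι ι' : ℕ → Word k} {π π' : ℕ → Bool} {c : Conjunct k}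
    (hι : ∀ z, c.HasVar z → ι z = ι' z) (hπ : ∀ s, c.HasParam s → π s = π' s)
    (h : c.Holds ι π) : c.Holds ι' π' := by
  cases c with
  | eqn z ys =>
    change ι' z = _
    rw [← hι z (.inl rfl), ← flatMap_congr_of_mem (ys := ys) fun y hy => hι y (.inr hy)]
    exact h
  | rat z R ys =>
    change R.Accepts π' ![ι' z, _]
    rw [← hι z (.inl rfl), ← flatMap_congr_of_mem (ys := ys) fun y hy => hι y (.inr hy)]
    exact AFT.Accepts.congr hπ h

theorem finite_hasVar (c : Conjunct k) : {z | c.HasVar z}.Finite :=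
  ((Set.finite_singleton c.lhs).union c.rhs.finite_toSet).subset fun _ hz => hz

theorem finite_hasParam (c : Conjunct k) : {s | c.HasParam s}.Finite := by
  cases c with
  | eqn z ys => simp [HasParam]
  | rat z R ys => exact R.finite_hasParam

end Conjunct

namespace Conj

variable {k : ℕ}

theorem finite_vars (φ : Conj k) : {z | ∃ c ∈ φ, c.HasVar z}.Finite := by
  have : {z | ∃ c ∈ φ, c.HasVar z} = ⋃ c ∈ {c | c ∈ φ}, {z | Conjunct.HasVar c z} := by
    ext; simp
  rw [this]
  exact φ.finite_toSet.biUnion fun c _ => c.finite_hasVar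

theorem finite_params (φ : Conj k) : {s | ∃ c ∈ φ, c.HasParam s}.Finite := by
  have : {s | ∃ c ∈ φ, c.HasParam s} = ⋃ c ∈ {c | c ∈ φ}, {s | Conjunct.HasParam c s} := by
    ext; simp
  rw [this]
  exact φ.finite_toSet.biUnion fun c _ => c.finite_hasParam

/-- The order-free form of being straight-line: left-hand sides are distinct, right-hand sides
are non-empty and of smaller rank, and `sz` assigns to every variable the number of pieces it is
finally split into. -/
structure Ranked (φ : Conj k) (rank sz : ℕ → ℕ) : Prop where
  nodup : (φ.map Conjunct.lhs).Nodup
  rhs_ne : ∀ c ∈ φ, c.rhs ≠ []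
  lt : ∀ c ∈ φ, ∀ y ∈ c.rhs, rank y < rank c.lhs
  pos : ∀ z, 0 < sz z
  size : ∀ c ∈ φ, sz c.lhs = (c.rhs.map sz).sum

theorem Ranked.perm {φ φ' : Conj k} {rank sz : ℕ → ℕ} (h : Ranked φ rank sz)
    (hp : φ.Perm φ') : Ranked φ' rank sz where
  nodup := (hp.map _).nodup_iff.1 h.nodup
  rhs_ne c hc := h.rhs_ne c (hp.mem_iff.2 hc)
  lt c hc := h.lt c (hp.mem_iff.2 hc)
  pos := h.pos
  size c hc := h.size c (hp.mem_iff.2 hc)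

theorem sum_map_pos {sz : ℕ → ℕ} (h : ∀ z, 0 < sz z) {ys : List ℕ} (hy : ys ≠ []) :
    0 < (ys.map sz).sum := by
  obtain ⟨y, ys, rfl⟩ := List.exists_cons_of_ne_nil hy
  simp [h y]

/-- The left-hand side of the last conjunct occurs in no earlier one, so its rank and size can be
overwritten freely: one more than the sum of the ranks on its right, and the sum of the sizes there.
Undefined variables keep rank 0 and size 1. -/
theorem exists_ranked_of_ordered (l : Conj k) (h₁ : ∀ c ∈ l, c.rhs ≠ [] ∧ c.lhs ∉ c.rhs)
    (h₂ : l.Pairwise fun c d => c.lhs ≠ d.lhs ∧ d.lhs ∉ c.rhs) :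
    ∃ rank sz, Ranked l rank sz := by
  induction l using List.reverseRecOn with
  | nil => exact ⟨fun _ => 0, fun _ => 1, by simp, by simp, by simp, by simp, by simp⟩
  | append_singleton l c ih =>
    rw [List.pairwise_append] at h₂
    obtain ⟨rank, sz, h⟩ := ih (fun d hd => h₁ d (by simp [hd])) h₂.1
    have hc := h₁ c (by simp)
    have hl : ∀ d ∈ l, d.lhs ≠ c.lhs ∧ c.lhs ∉ d.rhs := fun d hd => h₂.2.2 d hd c (by simp)
    have hne : ∀ ys : List ℕ, c.lhs ∉ ys → ∀ y ∈ ys, y ≠ c.lhs := fun ys hys y hy e =>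
      hys (e ▸ hy)
    have hsum : ∀ (f : ℕ → ℕ) (a : ℕ) (ys : List ℕ), c.lhs ∉ ys →
        ys.map (update f c.lhs a) = ys.map f := fun f a ys hys =>
      List.map_congr_left fun y hy => update_of_ne (hne ys hys y hy) _ _
    refine ⟨update rank c.lhs ((c.rhs.map rank).sum + 1), update sz c.lhs (c.rhs.map sz).sum,
      ?_, ?_, ?_, ?_, ?_⟩
    · rw [List.map_append, List.nodup_append']
      refine ⟨h.nodup, by simp, ?_⟩
      simp only [List.map_cons, List.map_nil, List.disjoint_singleton, List.mem_map, not_exists,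
        not_and]
      exact fun d hd => (hl d hd).1
    · exact fun d hd => (h₁ d hd).1
    · intro d hd y hy
      rcases List.mem_append.1 hd with hd | hd
      · rw [update_of_ne (hl d hd).1, update_of_ne (hne _ (hl d hd).2 y hy)]
        exact h.lt d hd y hy
      · rw [List.mem_singleton] at hd
        subst hd
        rw [update_self, update_of_ne (hne _ hc.2 y hy)]
        exact Nat.lt_succ_of_le (List.single_le_sum (by simp) _ (List.mem_map_of_mem hy))
    · intro z
      by_cases hz : z = c.lhs
      · rw [hz, update_self]
        exact sum_map_pos h.pos hc.1
      · rw [update_of_ne hz]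
        exact h.pos z
    · intro d hd
      rcases List.mem_append.1 hd with hd | hd
      · rw [update_of_ne (hl d hd).1, hsum _ _ _ (hl d hd).2]
        exact h.size d hd
      · rw [List.mem_singleton] at hd
        subst hd
        rw [update_self, hsum _ _ _ hc.2]

theorem IsGenSL.exists_ranked {φ : Conj k} (h : IsGenSL φ) : ∃ rank sz, Ranked φ rank sz := by
  obtain ⟨l, hp, h₁, h₂⟩ := h
  obtain ⟨rank, sz, h⟩ := exists_ranked_of_ordered l h₁ h₂
  exact ⟨rank, sz, h.perm hp⟩

theorem Holds.perm {φ φ' : Conj k} (hp : φ.Perm φ') {ι : ℕ → Word k} {π : ℕ → Bool} :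
    Holds ι π φ ↔ Holds ι π φ' :=
  forall_congr' fun _ => by rw [hp.mem_iff]

/-! ### Substitution -/

theorem acc_substStep (φ : Conj k) : Acc (fun b a => SubstStep a b) φ := by
  refine Subrelation.accessible (r := InvImage (· < ·) List.length) ?_ (InvImage.accessible _
    (Nat.lt_wfRel.wf.apply _))
  rintro b a ⟨x, ys, ψ, hp, rfl⟩
  simp [InvImage, hp.length_eq]

/-- The same `rank` and `sz` work: the inserted variables rank below `x`, and their sizes add up to
that of `x`. -/
theorem Ranked.substStep {φ φ' : Conj k} {rank sz : ℕ → ℕ} (h : Ranked φ rank sz)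
    (hs : SubstStep φ φ') : Ranked φ' rank sz := by
  obtain ⟨x, ys, ψ, hp, rfl⟩ := hs
  have h := h.perm hp
  have hx : sz x = (ys.map sz).sum := h.size _ List.mem_cons_self
  have hmem : ∀ c ∈ ψ, c ∈ Conjunct.eqn x ys :: ψ := fun c hc => List.mem_cons_of_mem _ hc
  refine ⟨?_, ?_, ?_, h.pos, ?_⟩
  · have hn := h.nodup
    rw [List.map_cons, List.nodup_cons] at hn
    rw [List.map_map]
    convert hn.2 using 2
    exact funext fun c => c.lhs_subst x ys
  · simp only [List.forall_mem_map, Conjunct.rhs_subst]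
    exact fun c hc => Conjunct.replaceVar_ne_nil (h.rhs_ne _ List.mem_cons_self)
      (h.rhs_ne c (hmem c hc))
  · simp only [List.forall_mem_map, Conjunct.rhs_subst, Conjunct.lhs_subst]
    intro c hc y hy
    rcases Conjunct.mem_replaceVar hy with hy | ⟨hx, hy⟩
    · exact h.lt c (hmem c hc) y hy
    · exact (h.lt _ List.mem_cons_self y hy).trans (h.lt c (hmem c hc) x hx)
  · simp only [List.forall_mem_map, Conjunct.rhs_subst, Conjunct.lhs_subst]
    intro c hc
    rw [Conjunct.sum_map_replaceVar sz hx.symm, h.size c (hmem c hc)]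

/-- The equation can be restored by setting `x` to the value of its right-hand side; since `x` is
not among `ys`, this does not disturb that value. -/
theorem Ranked.satisfiable_substStep {φ φ' : Conj k} {rank sz : ℕ → ℕ} (h : Ranked φ rank sz)
    (hs : SubstStep φ φ') : Satisfiable φ' ↔ Satisfiable φ := by
  obtain ⟨x, ys, ψ, hp, rfl⟩ := hs
  have h := h.perm hp
  have hn := h.nodup
  rw [List.map_cons, List.nodup_cons] at hn
  have hlhs : ∀ c ∈ ψ, c.lhs ≠ x := fun c hc e => hn.1 (List.mem_map.2 ⟨c, hc, e⟩)
  have hxy : ∀ y ∈ ys, y ≠ x := by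
    rintro y hy rfl
    exact lt_irrefl _ (h.lt _ List.mem_cons_self y hy)
  have hmap : ∀ ι π, Holds ι π (ψ.map (Conjunct.subst x ys)) ↔
      Holds (update ι x (ys.flatMap ι)) π ψ := fun ι π => by
    simp only [Holds, List.forall_mem_map]
    exact forall₂_congr fun c hc => Conjunct.holds_subst (hlhs c hc)
  constructor
  · rintro ⟨ι, π, hι⟩
    refine ⟨_, π, (Holds.perm hp).2 ((List.forall_mem_cons).2 ⟨?_, (hmap ι π).1 hι⟩)⟩
    change update ι x _ x = _
    rw [update_self]
    exact Conjunct.flatMap_congr_of_mem fun y hy => (update_of_ne (hxy y hy) _ _).symm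
  · rintro ⟨ι, π, hι⟩
    obtain ⟨h₁, h₂⟩ := List.forall_mem_cons.1 ((Holds.perm hp).1 hι)
    refine ⟨ι, π, (hmap ι π).2 ?_⟩
    rw [show ys.flatMap ι = ι x from h₁.symm, update_eq_self]
    exact h₂

theorem Ranked.substSteps {φ φ' : Conj k} {rank sz : ℕ → ℕ} (h : Ranked φ rank sz)
    (hs : Relation.ReflTransGen SubstStep φ φ') :
    Ranked φ' rank sz ∧ (Satisfiable φ' ↔ Satisfiable φ) := by
  induction hs with
  | refl => exact ⟨h, Iff.rfl⟩
  | tail _ hs ih => exact ⟨ih.1.substStep hs, (ih.1.satisfiable_substStep hs).trans ih.2⟩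

theorem exists_substituted (φ : Conj k) : ∃ φ₁, Substituted φ φ₁ := by
  induction acc_substStep φ with
  | intro φ _ ih =>
    by_cases hr : ∀ c ∈ φ, c.IsRational
    · exact ⟨φ, .refl, hr⟩
    · push Not at hr
      obtain ⟨c, hc, hr⟩ := hr
      cases c with
      | rat x R ys => exact absurd trivial hr
      | eqn x ys =>
        obtain ⟨l₁, l₂, rfl⟩ := List.append_of_mem hc
        have hs : SubstStep (l₁ ++ Conjunct.eqn x ys :: l₂) _ :=
          ⟨x, ys, l₁ ++ l₂, List.perm_middle, rfl⟩
        obtain ⟨φ₁, h₁, h₂⟩ := ih _ hs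
        exact ⟨φ₁, h₁.head hs, h₂⟩

/-! ### Splitting -/

/-- The number of splitting steps still to be carried out. -/
def splitMeasure (sz : ℕ → ℕ) (φ : Conj k) : ℕ := (φ.map fun c => sz c.lhs - 1).sum

/-- The fresh variables inherit the rank of `x` and receive the sizes of the two halves. These add
up to `sz x`, so replacing `x` by the pair leaves all other sizes additive. -/
theorem Ranked.splitStep {φ φ' : Conj k} {rank sz : ℕ → ℕ} (h : Ranked φ rank sz)
    (hs : SplitStep φ φ') :
    ∃ rank' sz', Ranked φ' rank' sz' ∧ splitMeasure sz' φ' < splitMeasure sz φ := by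
  obtain ⟨x, R, ys, zs, ψ, x₁, x₂, t, hp, hys, hzs, hne, hvar, -, -, rfl⟩ := hs
  have h := h.perm hp
  have hn := h.nodup
  rw [List.map_cons, List.nodup_cons] at hn
  have hvar : ∀ c ∈ Conjunct.rat x R (ys ++ zs) :: ψ, ¬ c.HasVar x₁ ∧ ¬ c.HasVar x₂ :=
    fun c hc => hvar c (hp.mem_iff.2 hc)
  have hmem : ∀ c ∈ ψ, c ∈ Conjunct.rat x R (ys ++ zs) :: ψ := fun c hc =>
    List.mem_cons_of_mem _ hc
  have hself := List.mem_cons_self (a := Conjunct.rat x R (ys ++ zs)) (l := ψ)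
  have hold : ∀ (f : ℕ → ℕ) (a b : ℕ), ∀ c ∈ Conjunct.rat x R (ys ++ zs) :: ψ, ∀ z, c.HasVar z →
      update (update f x₁ a) x₂ b z = f z := by
    intro f a b c hc z hz
    rw [update_of_ne, update_of_ne]
    · rintro rfl
      exact (hvar c hc).1 hz
    · rintro rfl
      exact (hvar c hc).2 hz
  have hx : sz x = (ys.map sz).sum + (zs.map sz).sum := by
    have := h.size _ hself
    simpa [Conjunct.lhs, Conjunct.rhs] using this
  have hvy : ∀ y ∈ ys, (Conjunct.rat x R (ys ++ zs)).HasVar y := fun y hy =>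
    .inr (List.mem_append_left _ hy)
  have hvz : ∀ y ∈ zs, (Conjunct.rat x R (ys ++ zs)).HasVar y := fun y hy =>
    .inr (List.mem_append_right _ hy)
  set rank' := update (update rank x₁ (rank x)) x₂ (rank x) with hrank
  set sz' := update (update sz x₁ (ys.map sz).sum) x₂ (zs.map sz).sum with hsz
  have hr₁ : rank' x₁ = rank x := by simp [hrank, update_of_ne hne]
  have hr₂ : rank' x₂ = rank x := by simp [hrank]
  have hs₁ : sz' x₁ = (ys.map sz).sum := by simp [hsz, update_of_ne hne]
  have hs₂ : sz' x₂ = (zs.map sz).sum := by simp [hsz]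
  have hmys : ys.map sz' = ys.map sz := List.map_congr_left fun y hy =>
    hold _ _ _ _ hself y (hvy y hy)
  have hmzs : zs.map sz' = zs.map sz := List.map_congr_left fun y hy =>
    hold _ _ _ _ hself y (hvz y hy)
  have hx' : ([x₁, x₂].map sz').sum = sz' x := by
    rw [hsz, hold _ _ _ _ hself x (.inl rfl), ← hsz]
    simp [hs₁, hs₂, hx]
  have hlhs : (Conjunct.lhs ∘ Conjunct.subst x [x₁, x₂] : Conjunct k → ℕ) = Conjunct.lhs :=
    funext fun c => c.lhs_subst _ _
  refine ⟨rank', sz', ⟨?_, ?_, ?_, ?_, ?_⟩, ?_⟩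
  · rw [List.map_cons, List.map_cons, List.map_map, hlhs, List.nodup_cons, List.nodup_cons]
    refine ⟨?_, ?_, hn.2⟩
    · rw [List.mem_cons, not_or]
      refine ⟨hne, fun hx₁ => ?_⟩
      obtain ⟨c, hc, e⟩ := List.mem_map.1 hx₁
      exact (hvar c (hmem c hc)).1 (.inl e.symm)
    · intro hx₂
      obtain ⟨c, hc, e⟩ := List.mem_map.1 hx₂
      exact (hvar c (hmem c hc)).2 (.inl e.symm)
  · simp only [List.forall_mem_cons, List.forall_mem_map, Conjunct.rhs_subst]
    exact ⟨hys, hzs, fun c hc => Conjunct.replaceVar_ne_nil (by simp) (h.rhs_ne c (hmem c hc))⟩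
  · simp only [List.forall_mem_cons, List.forall_mem_map, Conjunct.rhs_subst, Conjunct.lhs_subst]
    refine ⟨fun y hy => ?_, fun y hy => ?_, fun c hc y hy => ?_⟩
    · change y ∈ ys at hy
      change rank' y < rank' x₁
      rw [hr₁, hrank, hold _ _ _ _ hself y (hvy y hy)]
      exact h.lt _ hself y (List.mem_append_left _ hy)
    · change y ∈ zs at hy
      change rank' y < rank' x₂
      rw [hr₂, hrank, hold _ _ _ _ hself y (hvz y hy)]
      exact h.lt _ hself y (List.mem_append_right _ hy)
    · rw [hrank, hold _ _ _ _ (hmem c hc) c.lhs (.inl rfl), ← hrank]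
      rcases Conjunct.mem_replaceVar hy with hy | ⟨hx, hy⟩
      · rw [hrank, hold _ _ _ _ (hmem c hc) y (.inr hy)]
        exact h.lt c (hmem c hc) y hy
      · have := h.lt c (hmem c hc) x hx
        simp only [List.mem_cons, List.not_mem_nil, or_false] at hy
        rcases hy with rfl | rfl
        · rwa [hr₁]
        · rwa [hr₂]
  · intro z
    rw [hsz]
    by_cases hz₂ : z = x₂
    · rw [hz₂, update_self]
      exact sum_map_pos h.pos hzs
    · rw [update_of_ne hz₂]
      by_cases hz₁ : z = x₁
      · rw [hz₁, update_self]
        exact sum_map_pos h.pos hys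
      · rw [update_of_ne hz₁]
        exact h.pos z
  · simp only [List.forall_mem_cons, List.forall_mem_map, Conjunct.rhs_subst, Conjunct.lhs_subst]
    refine ⟨?_, ?_, fun c hc => ?_⟩
    · exact hs₁.trans (congrArg List.sum hmys.symm)
    · exact hs₂.trans (congrArg List.sum hmzs.symm)
    · rw [Conjunct.sum_map_replaceVar sz' hx', hsz, hold _ _ _ _ (hmem c hc) c.lhs (.inl rfl),
        h.size c (hmem c hc)]
      exact congrArg List.sum (List.map_congr_left fun y hy =>
        (hold _ _ _ _ (hmem c hc) y (.inr hy)).symm)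
  · have h1 : splitMeasure sz φ = splitMeasure sz (Conjunct.rat x R (ys ++ zs) :: ψ) :=
      (hp.map _).sum_eq
    have h2 : (ψ.map (Conjunct.subst x [x₁, x₂])).map (fun c => sz' c.lhs - 1) =
        ψ.map fun c => sz c.lhs - 1 := by
      rw [List.map_map]
      refine List.map_congr_left fun c hc => ?_
      rw [comp_apply, Conjunct.lhs_subst, hsz, hold _ _ _ _ (hmem c hc) c.lhs (.inl rfl)]
    -- Both halves have positive size, so truncated subtraction is harmless: `a + b - 1` is replaced
    -- by `(a - 1) + (b - 1)`.
    have h3 := sum_map_pos h.pos hys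
    have h4 := sum_map_pos h.pos hzs
    have h5 : ∀ y R zs, (Conjunct.rat y R zs : Conjunct k).lhs = y := fun _ _ _ => rfl
    rw [h1]
    simp only [splitMeasure, List.map_cons, List.sum_cons, h2, h5, hs₁, hs₂, hx]
    omega

theorem Ranked.acc_splitStep {φ : Conj k} {rank sz : ℕ → ℕ} (h : Ranked φ rank sz) :
    Acc (fun b a => SplitStep a b) φ := by
  induction hm : splitMeasure sz φ using Nat.strong_induction_on generalizing φ rank sz with
  | _ m ih =>
    refine ⟨_, fun φ' hs => ?_⟩
    obtain ⟨rank', sz', h', hlt⟩ := h.splitStep hs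
    exact ih _ (hm ▸ hlt) h' rfl

theorem Ranked.satisfiable_splitStep {φ φ' : Conj k} {rank sz : ℕ → ℕ} (h : Ranked φ rank sz)
    (hs : SplitStep φ φ') : Satisfiable φ' ↔ Satisfiable φ := by
  obtain ⟨x, R, ys, zs, ψ, x₁, x₂, t, hp, hys, hzs, hne, hvar, ht, hpar, rfl⟩ := hs
  have h := h.perm hp
  have hn := h.nodup
  rw [List.map_cons, List.nodup_cons] at hn
  have hvar : ∀ c ∈ Conjunct.rat x R (ys ++ zs) :: ψ, ¬ c.HasVar x₁ ∧ ¬ c.HasVar x₂ :=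
    fun c hc => hvar c (hp.mem_iff.2 hc)
  have hpar : ∀ c ∈ Conjunct.rat x R (ys ++ zs) :: ψ, ∀ q, ¬ c.HasParam (t q) :=
    fun c hc => hpar c (hp.mem_iff.2 hc)
  have hmem : ∀ c ∈ ψ, c ∈ Conjunct.rat x R (ys ++ zs) :: ψ := fun c hc =>
    List.mem_cons_of_mem _ hc
  have hself := List.mem_cons_self (a := Conjunct.rat x R (ys ++ zs)) (l := ψ)
  have hlhs : ∀ c ∈ ψ, c.lhs ≠ x := fun c hc e => hn.1 (List.mem_map.2 ⟨c, hc, e⟩)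
  have hxy : ∀ y ∈ ys ++ zs, y ≠ x := by
    rintro y hy rfl
    exact lt_irrefl _ (h.lt _ hself y hy)
  have hmap : ∀ ι π, Holds ι π (ψ.map (Conjunct.subst x [x₁, x₂])) ↔
      Holds (update ι x (ι x₁ ++ ι x₂)) π ψ := fun ι π => by
    simp only [Holds, List.forall_mem_map]
    refine forall₂_congr fun c hc => ?_
    rw [Conjunct.holds_subst (hlhs c hc)]
    simp
  constructor
  · rintro ⟨ι, π, hι⟩
    obtain ⟨h₁, hι⟩ := List.forall_mem_cons.1 hι
    obtain ⟨h₂, hι⟩ := List.forall_mem_cons.1 hι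
    refine ⟨_, π, (Holds.perm hp).2 ((List.forall_mem_cons).2 ⟨?_, (hmap ι π).1 hι⟩)⟩
    change R.Accepts π ![update ι x _ x, _]
    rw [update_self, ← Conjunct.flatMap_congr_of_mem (f := ι) (ys := ys ++ zs)
      fun y hy => (update_of_ne (hxy y hy) _ _).symm, List.flatMap_append]
    exact AFT.accepts_of_split h₁ h₂
  · rintro ⟨ι, π, hι⟩
    obtain ⟨h₁, h₂⟩ := List.forall_mem_cons.1 ((Holds.perm hp).1 hι)
    change R.Accepts π ![ι x, (ys ++ zs).flatMap ι] at h₁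
    rw [List.flatMap_append] at h₁
    obtain ⟨u₁, u₂, γ, hu, hγ⟩ := AFT.exists_split_of_accepts t h₁
    set ι' := update (update ι x₁ u₁) x₂ u₂ with hι'
    -- Injectivity of `t` lets the new parameters encode `γ`, and freshness keeps `π'` equal to `π`
    -- on every parameter already in use.
    set π' := extend t γ π with hπ'
    have hιeq : ∀ c ∈ Conjunct.rat x R (ys ++ zs) :: ψ, ∀ z, c.HasVar z → ι z = ι' z := by
      intro c hc z hz
      rw [hι', update_of_ne, update_of_ne]
      · rintro rfl
        exact (hvar c hc).1 hz
      · rintro rfl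
        exact (hvar c hc).2 hz
    have hπeq : ∀ c ∈ Conjunct.rat x R (ys ++ zs) :: ψ, ∀ s, c.HasParam s → π s = π' s := by
      intro c hc s hs
      rw [hπ', extend_apply']
      rintro ⟨q, rfl⟩
      exact hpar c hc q hs
    have hi₁ : ι' x₁ = u₁ := by simp [hι', update_of_ne hne]
    have hi₂ : ι' x₂ = u₂ := by simp [hι']
    obtain ⟨ha₁, ha₂⟩ := hγ π' (hπeq _ hself) fun q => ht.extend_apply _ _ q
    refine ⟨ι', π', List.forall_mem_cons.2 ⟨?_, List.forall_mem_cons.2 ⟨?_, (hmap ι' π').2 ?_⟩⟩⟩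
    · change (R.splitFst t).Accepts π' ![ι' x₁, ys.flatMap ι']
      rwa [hi₁, ← Conjunct.flatMap_congr_of_mem fun y hy =>
        hιeq _ hself y (.inr (List.mem_append_left _ hy))]
    · change (R.splitSnd t).Accepts π' ![ι' x₂, zs.flatMap ι']
      rwa [hi₂, ← Conjunct.flatMap_congr_of_mem fun y hy =>
        hιeq _ hself y (.inr (List.mem_append_right _ hy))]
    · rw [hi₁, hi₂, ← hu, hιeq _ hself x (.inl rfl), update_eq_self]
      exact fun c hc => Conjunct.Holds.congr (hιeq c (hmem c hc)) (hπeq c (hmem c hc)) (h₂ c hc)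

theorem SplitStep.isRational {φ φ' : Conj k} (hs : SplitStep φ φ')
    (h : ∀ c ∈ φ, c.IsRational) : ∀ c ∈ φ', c.IsRational := by
  obtain ⟨x, R, ys, zs, ψ, x₁, x₂, t, hp, -, -, -, -, -, -, rfl⟩ := hs
  simp only [List.forall_mem_cons, List.forall_mem_map, Conjunct.isRational_subst]
  exact ⟨trivial, trivial, fun c hc => h c (hp.mem_iff.2 (List.mem_cons_of_mem _ hc))⟩

theorem Ranked.splitSteps {φ φ' : Conj k} {rank sz : ℕ → ℕ} (h : Ranked φ rank sz)
    (hr : ∀ c ∈ φ, c.IsRational) (hs : Relation.ReflTransGen SplitStep φ φ') :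
    (∃ rank' sz', Ranked φ' rank' sz') ∧ (∀ c ∈ φ', c.IsRational) ∧
      (Satisfiable φ' ↔ Satisfiable φ) := by
  induction hs with
  | refl => exact ⟨⟨_, _, h⟩, hr, Iff.rfl⟩
  | tail _ hs ih =>
    obtain ⟨⟨rank', sz', h'⟩, hr', hsat⟩ := ih
    obtain ⟨rank'', sz'', h'', -⟩ := h'.splitStep hs
    exact ⟨⟨_, _, h''⟩, hs.isRational hr', (h'.satisfiable_splitStep hs).trans hsat⟩

theorem exists_splitStep {φ : Conj k} {x : ℕ} {R : AFT k 2} {y z : ℕ} {zs : List ℕ}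
    (hc : Conjunct.rat x R (y :: z :: zs) ∈ φ) : ∃ φ', SplitStep φ φ' := by
  obtain ⟨l₁, l₂, rfl⟩ := List.append_of_mem hc
  obtain ⟨N, hN⟩ := (finite_vars (l₁ ++ Conjunct.rat x R (y :: z :: zs) :: l₂)).bddAbove
  obtain ⟨M, hM⟩ := (finite_params (l₁ ++ Conjunct.rat x R (y :: z :: zs) :: l₂)).bddAbove
  -- `N` and `M` bound all variables and all parameters in use, so everything above them is fresh.
  refine ⟨_, x, R, [y], z :: zs, l₁ ++ l₂, N + 1, N + 2, fun q => M + 1 + q, List.perm_middle,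
    by simp, by simp, by simp, fun c hc => ⟨fun hv => ?_, fun hv => ?_⟩, fun a b hab => ?_,
    fun c hc q hq => ?_, rfl⟩
  · have := hN ⟨c, hc, hv⟩
    omega
  · have := hN ⟨c, hc, hv⟩
    omega
  · simpa [Fin.ext_iff] using hab
  · have : M + 1 + q ≤ M := hM ⟨c, hc, hq⟩
    omega

theorem exists_splitted {φ : Conj k} (ha : Acc (fun b a => SplitStep a b) φ)
    (hr : ∀ c ∈ φ, c.IsRational) : ∃ φ₂, Splitted φ φ₂ := by
  induction ha with
  | intro φ _ ih =>
    by_cases hl : ∀ c ∈ φ, c.rhs.length ≤ 1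
    · exact ⟨φ, .refl, hl⟩
    · push Not at hl
      obtain ⟨c, hc, hl⟩ := hl
      match c, hr c hc, hc, hl with
      | .rat x R (y :: z :: zs), _, hc, _ =>
        obtain ⟨φ', hs⟩ := exists_splitStep hc
        obtain ⟨φ₂, h₁, h₂⟩ := ih φ' hs (hs.isRational hr)
        exact ⟨φ₂, h₁.head hs, h₂⟩

/-! ### Reordering -/

theorem Ranked.exists_topologicalOrder {φ : Conj k} {rank sz : ℕ → ℕ} (h : Ranked φ rank sz) :
    ∃ pos, IsTopologicalOrder φ pos := by
  obtain ⟨N, hN⟩ := (finite_vars φ).bddAbove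
  obtain ⟨K, hK⟩ := ((finite_vars φ).image rank).bddAbove
  -- Order by decreasing rank, breaking ties by the name `z ≤ N`, which is recovered as the residue
  -- modulo `N + 1`.
  refine ⟨fun z => (K - rank z) * (N + 1) + z, ?_, ?_⟩
  · intro a ha b hb hab
    have ha' : a < N + 1 := Nat.lt_succ_of_le (hN ha)
    have hb' : b < N + 1 := Nat.lt_succ_of_le (hN hb)
    have := congrArg (· % (N + 1)) hab
    simpa [Nat.add_mod, Nat.mod_eq_of_lt ha', Nat.mod_eq_of_lt hb'] using this
  · intro c hc y hy
    have h1 := h.lt c hc y hy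
    have h2 : rank c.lhs ≤ K := hK ⟨c.lhs, ⟨c, hc, .inl rfl⟩, rfl⟩
    have h3 : c.lhs ≤ N := hN ⟨c, hc, .inl rfl⟩
    have h4 : (K - rank c.lhs + 1) * (N + 1) ≤ (K - rank y) * (N + 1) :=
      Nat.mul_le_mul_right _ (by omega)
    rw [Nat.add_mul, Nat.one_mul] at h4
    change (K - rank c.lhs) * (N + 1) + c.lhs < (K - rank y) * (N + 1) + y
    omega

theorem Ranked.exists_reorder {φ : Conj k} {rank sz : ℕ → ℕ} (h : Ranked φ rank sz)
    (hr : ∀ c ∈ φ, c.IsRational) (hl : ∀ c ∈ φ, c.rhs.length ≤ 1) : ∃ φ₃, Reorder φ φ₃ := by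
  classical
  obtain ⟨pos, hpos⟩ := h.exists_topologicalOrder
  have hex : ∃ l : List (ℕ × AFT k 2 × ℕ),
      (l.map fun c => Conjunct.rat c.1 c.2.1 [c.2.2]) = φ := by
    have : φ ∈ Set.range (List.map fun c : ℕ × AFT k 2 × ℕ => Conjunct.rat c.1 c.2.1 [c.2.2]) := by
      rw [Set.range_list_map]
      intro c hc
      match c, hr c hc, hl c hc, h.rhs_ne c hc with
      | .rat x R [y], _, _, _ => exact ⟨(x, R, y), rfl⟩
    exact this
  obtain ⟨l, rfl⟩ := hex
  let r : ℕ × AFT k 2 × ℕ → ℕ × AFT k 2 × ℕ → Prop := fun c d => pos c.1 ≤ pos d.1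
  have hperm : (l.insertionSort r).Perm l := l.perm_insertionSort r
  have : Std.Total r := ⟨fun a b => le_total (pos a.1) (pos b.1)⟩
  have : IsTrans _ r := ⟨fun a b c => le_trans⟩
  have hsort : (l.insertionSort r).Pairwise r := l.pairwise_insertionSort r
  refine ⟨_, l.insertionSort r, pos, hperm.map _, hpos, ?_, rfl⟩
  have hnd : ((l.insertionSort r).map Prod.fst).Nodup := by
    rw [(hperm.map _).nodup_iff]
    have := h.nodup
    rwa [List.map_map] at this
  have hne : (l.insertionSort r).Pairwise fun c d => c.1 ≠ d.1 := List.pairwise_map.1 hnd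
  -- Sorting gives only a weak inequality; it is strict because left-hand sides are distinct and
  -- `pos` is injective on the variables.
  refine (hsort.and hne).imp_of_mem fun {c d} hc hd hcd => lt_of_le_of_ne hcd.1 fun e => hcd.2 ?_
  refine hpos.1 ⟨_, List.mem_map_of_mem (hperm.mem_iff.1 hc), .inl rfl⟩
    ⟨_, List.mem_map_of_mem (hperm.mem_iff.1 hd), .inl rfl⟩ e

theorem holds_rightConj (l : List (ℕ × AFT k 2 × ℕ)) (ι : ℕ → Word k) (π : ℕ → Bool) :
    (rightConj l).Holds ι π ↔ Holds ι π (l.map fun c => Conjunct.rat c.1 c.2.1 [c.2.2]) := by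
  have hrat : ∀ c : ℕ × AFT k 2 × ℕ, (ratForm c).Holds ι π ↔
      (Conjunct.rat c.1 c.2.1 [c.2.2]).Holds ι π := by
    intro c
    change c.2.1.Accepts π (fun i => ι (![c.1, c.2.2] i)) ↔
      c.2.1.Accepts π ![ι c.1, [c.2.2].flatMap ι]
    have : (fun i => ι (![c.1, c.2.2] i)) = ![ι c.1, [c.2.2].flatMap ι] := by
      funext i
      fin_cases i <;> simp
    rw [this]
  induction l with
  | nil => simp [rightConj, SForm.Holds, Holds]
  | cons c l ih =>
    cases l with
    | nil => simp [rightConj, Holds, hrat]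
    | cons d l =>
      rw [List.map_cons, Holds, List.forall_mem_cons]
      exact and_congr (hrat c) ih

theorem vars_ratForm (c : ℕ × AFT k 2 × ℕ) : (ratForm c).vars = {c.1, c.2.2} := by
  ext z
  simp [ratForm, SForm.vars, eq_comm]

theorem mem_vars_rightConj {l : List (ℕ × AFT k 2 × ℕ)} {z : ℕ} (h : z ∈ (rightConj l).vars) :
    ∃ c ∈ l, z = c.1 ∨ z = c.2.2 := by
  induction l with
  | nil => simp [rightConj, SForm.vars] at h
  | cons c l ih =>
    have hc : z ∈ (ratForm c).vars → z = c.1 ∨ z = c.2.2 := by simp [vars_ratForm]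
    cases l with
    | nil => exact ⟨c, by simp, hc h⟩
    | cons d l =>
      rw [rightConj, SForm.vars, Finset.mem_union] at h
      rcases h with h | h
      · exact ⟨c, by simp, hc h⟩
      · obtain ⟨e, he, hz⟩ := ih h
        exact ⟨e, List.mem_cons_of_mem _ he, hz⟩

/-- Every variable of the tail is at, or beyond, the position of some later left-hand side, hence
strictly after `c.1`. Only `c.2.2` can be shared. -/
theorem acyclic_rightConj {l : List (ℕ × AFT k 2 × ℕ)} {pos : ℕ → ℕ}
    (h₁ : ∀ c ∈ l, pos c.1 < pos c.2.2) (h₂ : l.Pairwise fun c d => pos c.1 < pos d.1) :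
    (rightConj l).Acyclic := by
  have hrat : ∀ c ∈ l, (ratForm c).AcyclicAt true := by
    intro c hc
    refine ⟨rfl, ?_⟩
    have hne : c.1 ≠ c.2.2 := fun e => (e ▸ h₁ c hc).false
    intro i j hij
    fin_cases i <;> fin_cases j <;> simp_all
  induction l with
  | nil => trivial
  | cons c l ih =>
    cases l with
    | nil => exact hrat c (by simp)
    | cons d l =>
      rw [List.pairwise_cons] at h₂
      refine ⟨hrat c (by simp), ih (fun e he => h₁ e (List.mem_cons_of_mem _ he)) h₂.2
        (fun e he => hrat e (List.mem_cons_of_mem _ he)), fun _ => ?_⟩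
      refine (Finset.card_le_card (t := {c.2.2}) fun z hz => ?_).trans (by simp)
      rw [Finset.mem_inter, vars_ratForm] at hz
      obtain ⟨hz, hz'⟩ := hz
      obtain ⟨e, he, hze⟩ := mem_vars_rightConj hz'
      have h3 := h₂.1 e he
      have h4 := h₁ e (List.mem_cons_of_mem _ he)
      simp only [Finset.mem_insert, Finset.mem_singleton] at hz ⊢
      rcases hz with rfl | rfl
      · rcases hze with hze | hze
        · rw [hze] at h3
          omega
        · rw [hze] at h3
          omega
      · rfl

theorem Reorder.satisfiable_iff {φ : Conj k} {φ₃ : SForm k} (h : Reorder φ φ₃) :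
    φ₃.Satisfiable ↔ Satisfiable φ := by
  obtain ⟨l, pos, hp, -, -, rfl⟩ := h
  refine exists_congr fun ι => exists_congr fun π => ?_
  rw [holds_rightConj, Holds.perm hp]

theorem Reorder.acyclic {φ : Conj k} {φ₃ : SForm k} (h : Reorder φ φ₃) : φ₃.Acyclic := by
  obtain ⟨l, pos, hp, hpos, hl, rfl⟩ := h
  refine acyclic_rightConj (pos := pos) (fun c hc => ?_) hl
  exact hpos.2 _ (hp.mem_iff.1 (List.mem_map_of_mem hc)) c.2.2
    (by simp [Conjunct.rhs])

end Conj

end StringSL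

/-! ### Finite congruences and short runs -/

namespace StringSL

open Function

/-- The kernel of `h` is a congruence of the free monoid. -/
def IsCongr {α M : Type} (h : List α → M) : Prop :=
  ∀ u u' v v', h u = h u' → h v = h v' → h (u ++ v) = h (u' ++ v')

namespace AFA

variable {B P : Type}

/-- Loops can be cut out of a run while keeping the class of the word under a finite congruence
and its image under a homomorphism to a free monoid. -/
theorem Run.exists_short (A : AFA B P) {M γ : Type} [Fintype M] {h : List (B → Bool) → M}
    (hh : IsCongr h) {g : List (B → Bool) → List γ} (hg : ∀ u v, g (u ++ v) = g u ++ g v)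
    {α β : A.Config} {w : List (B → Bool)} (hw : A.Run α w β) :
    ∃ w', A.Run α w' β ∧ h w' = h w ∧ g w' = g w ∧
      w'.length ≤ 2 ^ A.states * Fintype.card M * ((g w).length + 1) := by
  induction hn : w.length using Nat.strong_induction_on generalizing w with
  | _ n ih =>
    by_cases hle : w.length ≤ 2 ^ A.states * Fintype.card M * ((g w).length + 1)
    · exact ⟨w, hw, rfl, rfl, hle⟩
    · have hex : ∀ i, ∃ δ, A.Run α (w.take i) δ ∧ A.Run δ (w.drop i) β := fun i => by
        rwa [← A.run_append, List.take_append_drop]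
      choose δ hδ₁ hδ₂ using hex
      have hlen : ∀ i, (g (w.take i)).length < (g w).length + 1 := fun i => by
        have := congrArg List.length (hg (w.take i) (w.drop i))
        rw [List.take_append_drop, List.length_append] at this
        omega
      -- Pigeonhole over the prefixes of `w`: configuration reached, class, and length of the image
      -- under `g`. If two prefixes agree in all three, the infix between them has empty image and
      -- can be removed.
      let f : Fin (w.length + 1) → A.Config × M × Fin ((g w).length + 1) := fun i =>
        (δ i, h (w.take i), ⟨_, hlen i⟩)
      have hcard : Fintype.card (A.Config × M × Fin ((g w).length + 1)) <
          Fintype.card (Fin (w.length + 1)) := by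
        simp only [Fintype.card_prod, Fintype.card_fin, Fintype.card_fun, Fintype.card_bool]
        rw [← mul_assoc]
        omega
      have hcut : ∃ i j : ℕ, i < j ∧ j ≤ w.length ∧ δ i = δ j ∧ h (w.take i) = h (w.take j) ∧
          (g (w.take i)).length = (g (w.take j)).length := by
        obtain ⟨i, j, hij, he⟩ := Fintype.exists_ne_map_eq_of_card_lt f hcard
        simp only [f, Prod.mk.injEq, Fin.mk.injEq] at he
        rcases lt_or_gt_of_ne hij with hlt | hlt
        · exact ⟨i, j, hlt, Nat.le_of_lt_succ j.2, he.1, he.2.1, he.2.2⟩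
        · exact ⟨j, i, hlt, Nat.le_of_lt_succ i.2, he.1.symm, he.2.1.symm, he.2.2.symm⟩
      obtain ⟨i, j, hij, hj, hδ, hhe, hge⟩ := hcut
      have hrun : A.Run α (w.take i ++ w.drop j) β :=
        (A.run_append _ _ _ _).2 ⟨δ i, hδ₁ i, hδ ▸ hδ₂ j⟩
      have hh' : h (w.take i ++ w.drop j) = h w := by
        conv_rhs => rw [← List.take_append_drop j w]
        exact hh _ _ _ _ hhe rfl
      have hg' : g (w.take i ++ w.drop j) = g w := by
        have hpre : g (w.take j) = g (w.take i) ++ g ((w.take j).drop i) := by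
          rw [← hg]
          congr 1
          conv_lhs => rw [← List.take_append_drop i (w.take j), List.take_take,
            min_eq_left hij.le]
        have hnil : g ((w.take j).drop i) = [] := by
          have := congrArg List.length hpre
          rw [List.length_append] at this
          exact List.length_eq_zero_iff.1 (by omega)
        conv_rhs => rw [← List.take_append_drop j w, hg, hpre, hnil, List.append_nil, ← hg]
      have hlt : (w.take i ++ w.drop j).length < n := by
        rw [List.length_append, List.length_take, List.length_drop]
        omega
      obtain ⟨w', h₁, h₂, h₃, h₄⟩ := ih _ hlt hrun rfl
      rw [hg'] at h₃ h₄
      exact ⟨w', h₁, h₂.trans hh', h₃, h₄⟩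

/-- The pairs of configurations that are connected by a run over the given word. -/
def connected (A : AFA B P) (w : List (B → Bool)) : Set (A.Config × A.Config) :=
  {p | A.Run p.1 w p.2}

theorem isCongr_connected (A : AFA B P) : IsCongr A.connected := by
  intro u u' v v' hu hv
  ext ⟨α, β⟩
  have hu' : ∀ γ, A.Run α u γ ↔ A.Run α u' γ := fun γ => Set.ext_iff.1 hu (α, γ)
  have hv' : ∀ γ, A.Run γ v β ↔ A.Run γ v' β := fun γ => Set.ext_iff.1 hv (γ, β)
  change A.Run α (u ++ v) β ↔ A.Run α (u' ++ v') β
  simp only [run_append, hu', hv']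

theorem accepts_iff_of_connected_eq (A : AFA B P) {u v : List (B → Bool)}
    (h : A.connected u = A.connected v) (π : P → Bool) : A.Accepts π u ↔ A.Accepts π v := by
  have h' : ∀ α β, A.Run α u β ↔ A.Run α v β := fun α β => Set.ext_iff.1 h (α, β)
  simp only [Accepts, h']

/-- The automaton without states. -/
def trivial (B P : Type) : AFA B P where
  states := 0
  trans _ := .tru
  init := .tru
  final := .tru
  trans_pos _ _ h := h
  init_pos _ h := h
  final_neg _ h := h

theorem run_trivial (α : (trivial B P).Config) (w : List (B → Bool)) :
    (trivial B P).Run α w α := by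
  induction w with
  | nil => rfl
  | cons b w ih => exact ⟨α, fun q => q.elim0, ih⟩

end AFA

/-- The case of the automaton without states and a trivial `g`: the bound `2 ^ 0 * card M * (0 + 1)`
collapses to the index. -/
theorem IsCongr.exists_short {B M : Type} [Fintype M] {h : List (B → Bool) → M} (hh : IsCongr h)
    (w : List (B → Bool)) : ∃ w', h w' = h w ∧ w'.length ≤ Fintype.card M := by
  obtain ⟨w', -, h₁, -, h₂⟩ := AFA.Run.exists_short (AFA.trivial B Empty) hh
    (g := fun _ => ([] : List Unit)) (fun _ _ => rfl)
    (AFA.run_trivial (fun _ => false) w)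
  refine ⟨w', h₁, ?_⟩
  simpa [AFA.trivial] using h₂

theorem IsCongr.prod {α M M' : Type} {h : List α → M} {h' : List α → M'} (hh : IsCongr h)
    (hh' : IsCongr h') : IsCongr fun w => (h w, h' w) := fun u u' v v' hu hv =>
  Prod.ext (hh u u' v v' (congrArg Prod.fst hu) (congrArg Prod.fst hv))
    (hh' u u' v v' (congrArg Prod.snd hu) (congrArg Prod.snd hv))

namespace AFT

variable {k : ℕ}

/-- The behaviour of a word on the second track: which configurations are connected by runs with
this word on the second track, and with words of which class on the first one. -/
def behaviour (R : AFT k 2) {M : Type} (h : Word k → M) (v : Word k) :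
    Set (R.aut.Config × M × R.aut.Config) :=
  {p | ∃ w, R.aut.Run p.1 w p.2.2 ∧ h (compact (track 0 w)) = p.2.1 ∧ v = compact (track 1 w)}

/-- A run is cut along its second track. Each half can be exchanged for one between the same
configurations with the same first-track class, and classes multiply because `h` is itself a
congruence. -/
theorem isCongr_behaviour (R : AFT k 2) {M : Type} {h : Word k → M} (hh : IsCongr h) :
    IsCongr (R.behaviour h) := by
  have key : ∀ u u' v v', R.behaviour h u = R.behaviour h u' → R.behaviour h v = R.behaviour h v' →
      R.behaviour h (u ++ v) ⊆ R.behaviour h (u' ++ v') := by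
    rintro u u' v v' hu hv ⟨α, m, β⟩ ⟨w, hr, hm, hw⟩
    obtain ⟨w₁, w₂, rfl, h₁, h₂⟩ := exists_split_of_compact_track 1 w u v hw
    obtain ⟨γ, hr₁, hr₂⟩ := (R.aut.run_append _ _ _ _).1 hr
    obtain ⟨w₁', hr₁', hm₁', h₁'⟩ : (α, h (compact (track 0 w₁)), γ) ∈ R.behaviour h u' := by
      rw [← hu]
      exact ⟨w₁, hr₁, rfl, h₁⟩
    obtain ⟨w₂', hr₂', hm₂', h₂'⟩ : (γ, h (compact (track 0 w₂)), β) ∈ R.behaviour h v' := by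
      rw [← hv]
      exact ⟨w₂, hr₂, rfl, h₂⟩
    refine ⟨w₁' ++ w₂', (R.aut.run_append _ _ _ _).2 ⟨γ, hr₁', hr₂'⟩, ?_, ?_⟩
    · rw [← hm, track_append, track_append, compact_append, compact_append]
      exact hh _ _ _ _ hm₁' hm₂'
    · rw [h₁', h₂', track_append, compact_append]
  exact fun u u' v v' hu hv => (key u u' v v' hu hv).antisymm (key u' u v' v hu.symm hv.symm)

end AFT

/-! ### Bounds for a smallest solution -/

/-- Bound for the index of a congruence after one more constraint has been taken into account. -/
def growth (N D : ℕ) : ℕ := D * 2 ^ (2 ^ N * 2 ^ N * D)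

theorem le_growth (N D : ℕ) : D ≤ growth N D := Nat.le_mul_of_pos_right _ (by positivity)

/-- Bound for the length of the words after `i` definitions have been evaluated. -/
def wordBound (N T i : ℕ) : ℕ := (fun b => (2 ^ N * T + N) * (b + 1))^[i] T

theorem wordBound_succ (N T i : ℕ) :
    wordBound N T (i + 1) = (2 ^ N * T + N) * (wordBound N T i + 1) := iterate_succ_apply' _ _ _

theorem wordBound_mono (N : ℕ) {T : ℕ} (hT : 0 < T) : Monotone (wordBound N T) := by
  refine monotone_nat_of_le_succ fun i => ?_
  rw [wordBound_succ]
  have : 0 < 2 ^ N * T := by positivity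
  exact (Nat.le_succ _).trans (Nat.le_mul_of_pos_left _ (by omega))

/-- Bound for the words and runs in a smallest solution of a conjunction of size `N`. -/
def solutionBound (N : ℕ) : ℕ := wordBound N ((growth N)^[2 * N] 1) N

/-- The cost of one refinement: `X` is the type of triples of a configuration, a class and a
configuration, or just of pairs of configurations. -/
theorem card_mul_card_set_le {M X : Type} [Fintype M] [Fintype X] {N D : ℕ}
    (hM : Fintype.card M ≤ D) (hX : Fintype.card X ≤ 2 ^ N * 2 ^ N * D) :
    Fintype.card (M × Set X) ≤ growth N D := by
  rw [Fintype.card_prod, Fintype.card_set]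
  exact Nat.mul_le_mul hM (Nat.pow_le_pow_right (by norm_num) hX)

/-- Every finite list of regular constraints is saturated by a congruence of small index. -/
theorem exists_isCongr_regs {k N : ℕ} (L : List (RegLit k)) (hN : ∀ c ∈ L, c.aut.states ≤ N) :
    ∃ (M : Type) (_ : Fintype M) (h : Word k → M), IsCongr h ∧
      Fintype.card M ≤ (growth N)^[L.length] 1 ∧ ∀ c ∈ L, ∀ u v, h u = h v →
        (c.aut.Accepts Empty.elim u ↔ c.aut.Accepts Empty.elim v) := by
  induction L with
  | nil => exact ⟨Unit, inferInstance, fun _ => (), fun _ _ _ _ _ _ => rfl, by simp, by simp⟩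
  | cons c L ih =>
    obtain ⟨M, _, h, hh, hM, hL⟩ := ih fun d hd => hN d (List.mem_cons_of_mem _ hd)
    refine ⟨M × Set (c.aut.Config × c.aut.Config), inferInstance, fun w => (h w, c.aut.connected w),
      hh.prod c.aut.isCongr_connected, ?_, ?_⟩
    · rw [List.length_cons, iterate_succ_apply']
      refine card_mul_card_set_le hM ?_
      have hc : 2 ^ c.aut.states ≤ 2 ^ N := Nat.pow_le_pow_right (by norm_num) (hN c (by simp))
      have h1 : 1 ≤ (growth N)^[L.length] 1 := (id_le_iterate_of_id_le (le_growth N) _ : _) 1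
      simp only [Fintype.card_prod, Fintype.card_fun, Fintype.card_bool, Fintype.card_fin]
      exact (Nat.mul_le_mul hc hc).trans (Nat.le_mul_of_pos_right _ h1)
    · intro d hd u v huv
      rcases List.mem_cons.1 hd with rfl | hd
      · exact d.aut.accepts_iff_of_connected_eq (congrArg Prod.snd huv) _
      · exact hL d hd u v (congrArg Prod.fst huv)

namespace Conjunct

variable {k : ℕ}

/-- Satisfaction witnessed by a word of length at most `b`, if the conjunct is rational. -/
def HoldsWithin (b : ℕ) (ι : ℕ → Word k) (π : ℕ → Bool) : Conjunct k → Prop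
  | eqn x ys => ι x = ys.flatMap ι
  | rat x R ys => ∃ w, w.length ≤ b ∧ R.aut.Accepts π w ∧ ι x = compact (track 0 w) ∧
      ys.flatMap ι = compact (track 1 w)

theorem HoldsWithin.holds {b : ℕ} {ι : ℕ → Word k} {π : ℕ → Bool} {c : Conjunct k}
    (h : c.HoldsWithin b ι π) : c.Holds ι π := by
  cases c with
  | eqn x ys => exact h
  | rat x R ys =>
    obtain ⟨w, -, ha, h₀, h₁⟩ := h
    refine ⟨w, ha, fun i => ?_⟩
    fin_cases i
    · exact h₀
    · exact h₁

theorem HoldsWithin.mono {b b' : ℕ} (hb : b ≤ b') {ι ι' : ℕ → Word k} {π : ℕ → Bool}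
    {c : Conjunct k} (hι : ∀ z, c.HasVar z → ι z = ι' z) (h : c.HoldsWithin b ι π) :
    c.HoldsWithin b' ι' π := by
  cases c with
  | eqn x ys =>
    change ι' x = _
    rw [← hι x (.inl rfl), ← flatMap_congr_of_mem (ys := ys) fun y hy => hι y (.inr hy)]
    exact h
  | rat x R ys =>
    obtain ⟨w, hw, ha, h₀, h₁⟩ := h
    refine ⟨w, hw.trans hb, ha, ?_, ?_⟩
    · rw [← h₀, hι x (.inl rfl)]
    · rw [← h₁, flatMap_congr_of_mem (ys := ys) fun y hy => hι y (.inr hy)]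

/-- The automaton and the right-hand side of the conjunct have size at most `N`. -/
def SizeLe (N : ℕ) : Conjunct k → Prop
  | eqn _ ys => ys.length ≤ N
  | rat _ R ys => R.aut.states ≤ N ∧ ∃ y, ys = [y]

end Conjunct

theorem IsCongr.flatMap {k : ℕ} {M : Type} {h : Word k → M} (hh : IsCongr h)
    {ι ι' : ℕ → Word k} (hι : ∀ z, h (ι z) = h (ι' z)) (ys : List ℕ) :
    h (ys.flatMap ι) = h (ys.flatMap ι') := by
  induction ys with
  | nil => rfl
  | cons y ys ih => exact hh _ _ _ _ (hι y) ih

theorem length_flatMap_le {α β : Type} {f : α → List β} {b : ℕ} (hf : ∀ a, (f a).length ≤ b)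
    (l : List α) : (l.flatMap f).length ≤ l.length * b := by
  induction l with
  | nil => simp
  | cons a l ih =>
    rw [List.flatMap_cons, List.length_append, List.length_cons, Nat.succ_mul]
    have := hf a
    omega

/-- Every solution of an ordered conjunction can be replaced by one with short words in the same
classes of a finite congruence. -/
theorem Conj.exists_short_solution {k N T : ℕ} (l : Conj k) (hN : ∀ c ∈ l, c.SizeLe N)
    (h₁ : ∀ c ∈ l, c.rhs ≠ [] ∧ c.lhs ∉ c.rhs)
    (h₂ : l.Pairwise fun c d => c.lhs ≠ d.lhs ∧ d.lhs ∉ c.rhs)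
    {M : Type} [Fintype M] {h : Word k → M} (hh : IsCongr h) {j : ℕ}
    (hM : Fintype.card M ≤ (growth N)^[j] 1) (hT : (growth N)^[j + l.length] 1 ≤ T)
    {ι : ℕ → Word k} {π : ℕ → Bool} (hι : Conj.Holds ι π l) :
    ∃ ι' : ℕ → Word k, (∀ z, (ι' z).length ≤ wordBound N T l.length) ∧
      (∀ z, h (ι' z) = h (ι z)) ∧ ∀ c ∈ l, c.HoldsWithin (wordBound N T l.length) ι' π := by
  -- The congruence is generalised because it is refined on the way down; `j` counts the refinements
  -- so far, and `T` bounds the index after the last one.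
  induction l using List.reverseRecOn generalizing M j with
  | nil =>
    choose f hf₁ hf₂ using fun z => hh.exists_short (ι z)
    exact ⟨f, fun z => (hf₂ z).trans (hM.trans hT), hf₁, by simp⟩
  | append_singleton l c ih =>
    rw [List.pairwise_append] at h₂
    have hl : ∀ d ∈ l, d.lhs ≠ c.lhs ∧ c.lhs ∉ d.rhs := fun d hd => h₂.2.2 d hd c (by simp)
    have hdis : ∀ (ι' : ℕ → Word k) (a : Word k), ∀ d ∈ l, ∀ z, d.HasVar z →
        ι' z = update ι' c.lhs a z := by
      intro ι' a d hd z hz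
      rw [update_of_ne]
      rintro rfl
      rcases hz with hz | hz
      · exact (hl d hd).1 hz.symm
      · exact (hl d hd).2 hz
    have hcr : ∀ (ι' : ℕ → Word k) (a : Word k),
        c.rhs.flatMap (update ι' c.lhs a) = c.rhs.flatMap ι' := fun ι' a =>
      Conjunct.flatMap_congr_of_mem fun y hy => update_of_ne
        (fun e : y = c.lhs => (h₁ c (by simp)).2 (e ▸ hy)) _ _
    have ih' := fun (M : Type) (_ : Fintype M) (h : Word k → M) (hh : IsCongr h)
      (hM : Fintype.card M ≤ (growth N)^[j + 1] 1) =>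
      ih (fun d hd => hN d (by simp [hd])) (fun d hd => h₁ d (by simp [hd])) h₂.1 hh hM
        (by rwa [List.length_append, List.length_singleton, add_comm l.length, ← add_assoc] at hT)
        (fun d hd => hι d (by simp [hd]))
    have hTpos : 0 < T := by
      have : 1 ≤ (growth N)^[j + (l ++ [c]).length] 1 :=
        (id_le_iterate_of_id_le (le_growth N) _ : _) 1
      omega
    have hMT : Fintype.card M ≤ T :=
      (hM.trans (monotone_iterate_of_id_le (le_growth N) (Nat.le_add_right _ _) 1)).trans hT
    have hstep := wordBound_succ N T l.length
    have hmono := wordBound_mono N hTpos (Nat.le_succ l.length)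
    have hlen : (l ++ [c]).length = l.length + 1 := by simp
    rw [hlen]
    have hc := hN c (by simp)
    have hιc := hι c (by simp)
    set W := wordBound N T l.length
    set W' := wordBound N T (l.length + 1)
    -- The variable `c.lhs` does not occur in `l`, so it suffices to solve `l` and then assign a
    -- suitable value `a` to it.
    suffices hs : ∃ (ι' : ℕ → Word k) (a : Word k), (∀ z, (ι' z).length ≤ W) ∧
        (∀ z, h (ι' z) = h (ι z)) ∧ (∀ d ∈ l, d.HoldsWithin W ι' π) ∧ a.length ≤ W' ∧
        h a = h (ι c.lhs) ∧ c.HoldsWithin W' (update ι' c.lhs a) π by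
      obtain ⟨ι', a, hW, hhι, hd, ha, hha, hca⟩ := hs
      refine ⟨update ι' c.lhs a, fun z => ?_, fun z => ?_, fun d hdl => ?_⟩
      · by_cases hz : z = c.lhs
        · rwa [hz, update_self]
        · rw [update_of_ne hz]
          exact (hW z).trans hmono
      · by_cases hz : z = c.lhs
        · rwa [hz, update_self]
        · rw [update_of_ne hz]
          exact hhι z
      · rcases List.mem_append.1 hdl with hdl | hdl
        · exact (hd d hdl).mono hmono (hdis ι' a d hdl)
        · rwa [List.mem_singleton.1 hdl]
    cases c with
    | eqn x ys =>
      obtain ⟨ι', hW, hhι, hd⟩ := ih' M inferInstance h hh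
        (hM.trans (monotone_iterate_of_id_le (le_growth N) (Nat.le_succ j) 1))
      refine ⟨ι', ys.flatMap ι', hW, hhι, hd, ?_, ?_, ?_⟩
      · calc (ys.flatMap ι').length ≤ ys.length * W := length_flatMap_le hW ys
          _ ≤ (2 ^ N * T + N) * (W + 1) :=
            Nat.mul_le_mul ((show ys.length ≤ N from hc).trans (Nat.le_add_left _ _))
              (Nat.le_succ _)
          _ = W' := hstep.symm
      · rw [show ι (Conjunct.eqn x ys).lhs = ys.flatMap ι from hιc]
        exact hh.flatMap hhι ys
      · exact (update_self _ _ _).trans (hcr ι' _).symm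
    | rat x R ys =>
      obtain ⟨hR, y, rfl⟩ := hc
      obtain ⟨w, ⟨α, β, hr, hi, hf⟩, hw⟩ := hιc
      have hw₀ : ι x = compact (track 0 w) := hw 0
      have hw₁ : [y].flatMap ι = compact (track 1 w) := hw 1
      rw [List.flatMap_singleton] at hw₁
      have hcard : Fintype.card (M × Set (R.aut.Config × M × R.aut.Config)) ≤
          (growth N)^[j + 1] 1 := by
        rw [iterate_succ_apply']
        refine card_mul_card_set_le hM ?_
        have h2 : 2 ^ R.aut.states ≤ 2 ^ N := Nat.pow_le_pow_right (by norm_num) hR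
        simp only [Fintype.card_prod, Fintype.card_fun, Fintype.card_bool, Fintype.card_fin]
        calc _ = 2 ^ R.aut.states * 2 ^ R.aut.states * Fintype.card M := by ring
          _ ≤ _ := Nat.mul_le_mul (Nat.mul_le_mul h2 h2) hM
      -- With the refined congruence, the new value of `y` still allows a run from `α` to `β` whose
      -- first track lies in the class of the old `x`.
      obtain ⟨ι', hW, hhι, hd⟩ := ih' _ inferInstance (fun v => (h v, R.behaviour h v))
        (hh.prod (R.isCongr_behaviour hh)) hcard
      obtain ⟨w₁, hr₁, hm₁, hy₁⟩ : (α, h (ι x), β) ∈ R.behaviour h (ι' y) := by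
        rw [(Prod.mk.inj (hhι y)).2]
        exact ⟨w, hr, by rw [hw₀], hw₁⟩
      have hhx : IsCongr fun w : List ((Fin k ⊕ Fin R.eps) × Fin 2 → Bool) =>
          h (compact (track 0 w)) := by
        intro u u' v v' hu hv
        simp only [track_append, compact_append]
        exact hh _ _ _ _ hu hv
      -- Shortening must preserve the second track exactly, since `y` is already fixed, but the
      -- first track only up to its class.
      obtain ⟨w₂, hr₂, hm₂, hy₂, hl₂⟩ := hr₁.exists_short R.aut hhx
        (g := fun w => compact (track 1 w)) (fun u v => by rw [track_append, compact_append])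
      have hw₂ : w₂.length ≤ W' := by
        refine hl₂.trans ?_
        rw [← hy₁, hstep]
        refine Nat.mul_le_mul ?_ (Nat.succ_le_succ (hW y))
        exact (Nat.mul_le_mul (Nat.pow_le_pow_right (by norm_num) hR) hMT).trans
          (Nat.le_add_right _ _)
      refine ⟨ι', compact (track 0 w₂), hW, fun z => (Prod.mk.inj (hhι z)).1, hd, ?_, ?_, ?_⟩
      · refine le_trans ?_ hw₂
        refine (List.length_filterMap_le _ _).trans ?_
        rw [track, List.length_map]
      · exact hm₂.trans hm₁
      · refine ⟨w₂, hw₂, ⟨α, β, hr₂, hi, hf⟩, update_self _ _ _, ?_⟩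
        refine (hcr ι' _).trans ?_
        change [y].flatMap ι' = _
        rw [List.flatMap_singleton, hy₁, hy₂]

/-- A straight-line conjunction of size at most `N` is satisfiable iff it has a solution in which
all words and all runs have length at most `solutionBound N`. -/
theorem SLConj.satisfiable_iff_bounded {k N : ℕ} (φ : SLConj k)
    (hr : ∀ c ∈ φ.regs, c.aut.states ≤ N) (hrl : φ.regs.length ≤ N)
    (hd : ∀ c ∈ φ.defs, c.SizeLe N) (hdl : φ.defs.length ≤ N) :
    φ.Satisfiable ↔ ∃ ι : ℕ → Word k, (∀ z, (ι z).length ≤ solutionBound N) ∧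
      (∀ c ∈ φ.regs, c.Holds ι) ∧
      ∀ c ∈ φ.defs, c.HoldsWithin (solutionBound N) ι fun _ => false := by
  constructor
  · rintro ⟨ι, π, hreg, hdef⟩
    -- The transducers are parameter-free, so any fixed assignment serves.
    have hdef' : Conj.Holds ι (fun _ => false) φ.defs := by
      intro c hc
      have := hdef c hc
      cases c with
      | eqn x ys => exact this
      | rat x R ys =>
        exact AFT.Accepts.congr (fun s hs => absurd hs ((φ.isSL.2 x R ys hc).1 s)) this
    obtain ⟨M, _, h, hh, hM, hL⟩ := exists_isCongr_regs φ.regs hr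
    obtain ⟨⟨l, hp, h₁, h₂⟩, -⟩ := φ.isSL
    -- At most `N` refinements come from the regular constraints and at most `N` from the
    -- definitions, hence `2 * N`.
    have hTpos : 0 < (growth N)^[2 * N] 1 := (id_le_iterate_of_id_le (le_growth N) _ : _) 1
    have hll : l.length ≤ N := hp.length_eq ▸ hdl
    have hb : wordBound N ((growth N)^[2 * N] 1) l.length ≤ solutionBound N :=
      wordBound_mono N hTpos hll
    obtain ⟨ι', hW, hhι, hι'⟩ := Conj.exists_short_solution (T := (growth N)^[2 * N] 1) l
      (fun c hc => hd c (hp.mem_iff.1 hc)) h₁ h₂ hh hM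
      (monotone_iterate_of_id_le (le_growth N) (by omega) 1)
      ((Conj.Holds.perm hp).2 hdef')
    refine ⟨ι', fun z => (hW z).trans hb, fun c hc => ?_, fun c hc => ?_⟩
    · have h3 := hreg c hc
      have h4 := hL c hc _ _ (hhι c.var)
      simpa only [RegLit.Holds, h4] using h3
    · exact (hι' c (hp.mem_iff.2 hc)).mono hb fun _ _ => rfl
  · rintro ⟨ι, -, hreg, hdef⟩
    exact ⟨ι, fun _ => false, hreg, fun c hc => (hdef c hc).holds⟩

end StringSL

-- Primitive recursive bounded search

attribute [fun_prop] Primrec PrimrecPred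
attribute [fun_prop] Primrec.id Primrec.const Primrec.comp

namespace StringSL

open Encodable

/-- All lists of length at most `n` with entries from `l`. -/
def listsUpTo {α : Type} (n : ℕ) (l : List α) : List (List α) :=
  (fun ih => [] :: ih.flatMap fun t => l.map fun a => a :: t)^[n] [[]]

theorem mem_listsUpTo {α : Type} {n : ℕ} {l t : List α} :
    t ∈ listsUpTo n l ↔ t.length ≤ n ∧ ∀ a ∈ t, a ∈ l := by
  induction n generalizing t with
  | zero =>
    simp only [listsUpTo, Function.iterate_zero, id, List.mem_singleton, Nat.le_zero,
      List.length_eq_zero_iff]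
    exact ⟨fun h => ⟨h, by simp [h]⟩, fun h => h.1⟩
  | succ n ih =>
    rw [listsUpTo, Function.iterate_succ_apply', ← listsUpTo]
    cases t with
    | nil => simp
    | cons a t =>
      simp [ih]
      tauto

/-! ### Primitive recursion -/

section Primrec

variable {α β γ σ : Type} [Primcodable α] [Primcodable β] [Primcodable γ] [Primcodable σ]

-- The closure properties are stated in composed form, so that `fun_prop` can decompose the search
-- predicate by itself.
@[fun_prop]
theorem primrec_fst {f : α → β × γ} (hf : Primrec f) : Primrec fun a => (f a).1 :=
  Primrec.fst.comp hf

@[fun_prop]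
theorem primrec_snd {f : α → β × γ} (hf : Primrec f) : Primrec fun a => (f a).2 :=
  Primrec.snd.comp hf

@[fun_prop]
theorem primrec_pair {f : α → β} {g : α → γ} (hf : Primrec f) (hg : Primrec g) :
    Primrec fun a => (f a, g a) := Primrec.pair hf hg

@[fun_prop]
theorem primrec_add {f g : α → ℕ} (hf : Primrec f) (hg : Primrec g) :
    Primrec fun a => f a + g a := Primrec.nat_add.comp hf hg

@[fun_prop]
theorem primrec_mul {f g : α → ℕ} (hf : Primrec f) (hg : Primrec g) :
    Primrec fun a => f a * g a := Primrec.nat_mul.comp hf hg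

@[fun_prop]
theorem primrec_pow {f g : α → ℕ} (hf : Primrec f) (hg : Primrec g) :
    Primrec fun a => f a ^ g a := (Primrec₂.unpaired'.1 Nat.Primrec.pow).comp hf hg

@[fun_prop]
theorem primrec_natPair {f g : α → ℕ} (hf : Primrec f) (hg : Primrec g) :
    Primrec fun a => Nat.pair (f a) (g a) := Primrec₂.natPair.comp hf hg

@[fun_prop]
theorem primrec_unpair {f : α → ℕ} (hf : Primrec f) : Primrec fun a => (f a).unpair :=
  Primrec.unpair.comp hf

@[fun_prop]
theorem primrec_iterate {f : α → ℕ} {g : α → β} {h : α → β → β} (hf : Primrec f)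
    (hg : Primrec g) (hh : Primrec fun x : α × β => h x.1 x.2) :
    Primrec fun a => (h a)^[f a] (g a) := Primrec.nat_iterate hf hg hh

@[fun_prop]
theorem primrec_and {f g : α → Bool} (hf : Primrec f) (hg : Primrec g) :
    Primrec fun a => f a && g a := Primrec.and.comp hf hg

@[fun_prop]
theorem primrec_or {f g : α → Bool} (hf : Primrec f) (hg : Primrec g) :
    Primrec fun a => f a || g a := Primrec.or.comp hf hg

@[fun_prop]
theorem primrec_not {f : α → Bool} (hf : Primrec f) : Primrec fun a => !(f a) :=
  Primrec.not.comp hf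

@[fun_prop]
theorem primrec_ite {p : α → Prop} [DecidablePred p] {f g : α → β} (hp : PrimrecPred p)
    (hf : Primrec f) (hg : Primrec g) : Primrec fun a => if p a then f a else g a :=
  Primrec.ite hp hf hg

@[fun_prop]
theorem primrec_decide {p : α → Prop} [DecidablePred p] (hp : PrimrecPred p) :
    Primrec fun a => decide (p a) := hp.decide

@[fun_prop]
theorem primrec_length {f : α → List β} (hf : Primrec f) : Primrec fun a => (f a).length :=
  Primrec.list_length.comp hf

@[fun_prop]
theorem primrec_append {f g : α → List β} (hf : Primrec f) (hg : Primrec g) :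
    Primrec fun a => f a ++ g a := Primrec.list_append.comp hf hg

@[fun_prop]
theorem primrec_cons {f : α → β} {g : α → List β} (hf : Primrec f) (hg : Primrec g) :
    Primrec fun a => f a :: g a := Primrec.list_cons.comp hf hg

@[fun_prop]
theorem primrec_range {f : α → ℕ} (hf : Primrec f) : Primrec fun a => List.range (f a) :=
  Primrec.list_range.comp hf

@[fun_prop]
theorem primrec_getD (d : β) {f : α → List β} {g : α → ℕ} (hf : Primrec f) (hg : Primrec g) :
    Primrec fun a => (f a).getD (g a) d := (Primrec.list_getD d).comp hf hg

@[fun_prop]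
theorem primrec_map {f : α → List β} {g : α → β → γ} (hf : Primrec f)
    (hg : Primrec fun x : α × β => g x.1 x.2) : Primrec fun a => (f a).map (g a) :=
  Primrec.list_map hf hg

@[fun_prop]
theorem primrec_flatMap {f : α → List β} {g : α → β → List γ} (hf : Primrec f)
    (hg : Primrec fun x : α × β => g x.1 x.2) : Primrec fun a => (f a).flatMap (g a) :=
  Primrec.list_flatMap hf hg

@[fun_prop]
theorem primrec_filterMap {f : α → List β} {g : α → β → Option γ} (hf : Primrec f)
    (hg : Primrec fun x : α × β => g x.1 x.2) : Primrec fun a => (f a).filterMap (g a) :=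
  Primrec.listFilterMap hf hg

@[fun_prop]
theorem primrec_foldl {f : α → List β} {g : α → σ} {h : α → σ → β → σ} (hf : Primrec f)
    (hg : Primrec g) (hh : Primrec fun x : α × σ × β => h x.1 x.2.1 x.2.2) :
    Primrec fun a => (f a).foldl (h a) (g a) :=
  Primrec.list_foldl (h := fun a p => h a p.1 p.2) hf hg hh

@[fun_prop]
theorem primrec_some {f : α → β} (hf : Primrec f) : Primrec fun a => some (f a) :=
  Primrec.option_some.comp hf

@[fun_prop]
theorem primrecPred_and {p q : α → Prop} (hp : PrimrecPred p) (hq : PrimrecPred q) :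
    PrimrecPred fun a => p a ∧ q a := hp.and hq

@[fun_prop]
theorem primrecPred_or {p q : α → Prop} (hp : PrimrecPred p) (hq : PrimrecPred q) :
    PrimrecPred fun a => p a ∨ q a := hp.or hq

@[fun_prop]
theorem primrecPred_not {p : α → Prop} (hp : PrimrecPred p) : PrimrecPred fun a => ¬ p a :=
  hp.not

@[fun_prop]
theorem primrecPred_eq {f g : α → β} (hf : Primrec f) (hg : Primrec g) :
    PrimrecPred fun a => f a = g a := Primrec.eq.comp hf hg

@[fun_prop]
theorem primrecPred_exists_mem {f : α → List β} {p : α → β → Prop} (hf : Primrec f)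
    (hp : PrimrecPred fun x : α × β => p x.1 x.2) : PrimrecPred fun a => ∃ b ∈ f a, p a b :=
  PrimrecRel.comp (PrimrecRel.exists_mem_list (R := fun b a => p a b)
    (PrimrecPred.comp hp (Primrec.pair Primrec.snd Primrec.fst))) hf Primrec.id

@[fun_prop]
theorem primrecPred_forall_mem {f : α → List β} {p : α → β → Prop} (hf : Primrec f)
    (hp : PrimrecPred fun x : α × β => p x.1 x.2) : PrimrecPred fun a => ∀ b ∈ f a, p a b :=
  PrimrecRel.comp (PrimrecRel.forall_mem_list (R := fun b a => p a b)
    (PrimrecPred.comp hp (Primrec.pair Primrec.snd Primrec.fst))) hf Primrec.id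

@[fun_prop]
theorem primrecPred_mem {f : α → List β} {g : α → β} (hf : Primrec f) (hg : Primrec g) :
    PrimrecPred fun a => g a ∈ f a := by
  have : PrimrecPred fun a => ∃ b ∈ f a, b = g a := by fun_prop
  exact this.of_eq fun a => by simp

@[fun_prop]
theorem primrec_filter {f : α → List β} {p : α → β → Prop} [∀ a, DecidablePred (p a)]
    (hf : Primrec f) (hp : PrimrecPred fun x : α × β => p x.1 x.2) :
    Primrec fun a => (f a).filter fun b => decide (p a b) := by
  have : Primrec fun a => (f a).filterMap fun b => if p a b then some b else none := by fun_prop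
  refine this.of_eq fun a => ?_
  rw [← List.filterMap_eq_filter]
  congr 1
  funext b
  simp [Option.guard]

/-- The object with the given code. -/
def decodeD (α : Type) [Primcodable α] [Inhabited α] (n : ℕ) : α := (decode n).getD default

theorem decodeD_encode [Inhabited α] (a : α) : decodeD α (encode a) = a := by
  simp [decodeD]

@[fun_prop]
theorem primrec_decodeD [Inhabited β] {f : α → ℕ} (hf : Primrec f) :
    Primrec fun a => decodeD β (f a) :=
  Primrec.option_getD_default.comp (Primrec.decode.comp hf)

@[fun_prop]
theorem primrec_listsUpTo {f : α → ℕ} {g : α → List β} (hf : Primrec f) (hg : Primrec g) :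
    Primrec fun a => listsUpTo (f a) (g a) := by
  unfold listsUpTo
  fun_prop

@[fun_prop]
theorem primrec_solutionBound {f : α → ℕ} (hf : Primrec f) :
    Primrec fun a => solutionBound (f a) := by
  have : Primrec solutionBound := by
    unfold solutionBound wordBound growth
    fun_prop
  exact this.comp hf

end Primrec

/-! ### Evaluation of formulae given by codes -/

/-- Value of the formula whose code is the length of `prev`, where `prev` lists the values of the
formulae with smaller codes and `L` the codes of the true atoms. -/
def evalStep (L : List ℕ) (prev : List Bool) : Bool :=
  if prev.length.unpair.1 = 0 then true
  else if prev.length.unpair.1 = 1 then false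
  else if prev.length.unpair.1 = 2 then decide (prev.length.unpair.2 ∈ L)
  else if prev.length.unpair.1 = 3 then !(prev.getD prev.length.unpair.2 false)
  else if prev.length.unpair.1 = 4 then
    prev.getD prev.length.unpair.2.unpair.1 false && prev.getD prev.length.unpair.2.unpair.2 false
  else
    prev.getD prev.length.unpair.2.unpair.1 false || prev.getD prev.length.unpair.2.unpair.2 false

/-- Values of the formulae with codes below `n`. -/
def evalTable (L : List ℕ) (n : ℕ) : List Bool := (fun prev => prev ++ [evalStep L prev])^[n] []

/-- Value of the formula with code `n`. -/
def evalCode (L : List ℕ) (n : ℕ) : Bool := evalStep L (evalTable L n)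

@[fun_prop]
theorem primrec_evalCode {α : Type} [Primcodable α] {f : α → List ℕ} {g : α → ℕ}
    (hf : Primrec f) (hg : Primrec g) : Primrec fun a => evalCode (f a) (g a) := by
  unfold evalCode evalTable evalStep
  fun_prop

theorem evalTable_succ (L : List ℕ) (n : ℕ) :
    evalTable L (n + 1) = evalTable L n ++ [evalCode L n] := Function.iterate_succ_apply' _ _ _

theorem length_evalTable (L : List ℕ) (n : ℕ) : (evalTable L n).length = n := by
  induction n with
  | zero => rfl
  | succ n ih => simp [evalTable_succ, ih]

theorem getD_evalTable (L : List ℕ) {i n : ℕ} (h : i < n) :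
    (evalTable L n).getD i false = evalCode L i := by
  induction n with
  | zero => omega
  | succ n ih =>
    rw [evalTable_succ]
    rcases Nat.lt_succ_iff_lt_or_eq.1 h with h | rfl
    · rw [List.getD_append _ _ _ _ (by rwa [length_evalTable]), ih h]
    · rw [List.getD_append_right _ _ _ _ (length_evalTable L i).le, length_evalTable]
      simp

/-- Compound formulae carry a positive tag, so their subformulae have strictly smaller codes and are
already in the table of values. -/
theorem lt_pair_of_pos {a : ℕ} (b : ℕ) (h : 0 < a) : b < Nat.pair a b :=
  (Nat.right_le_pair 0 b).trans_lt (Nat.pair_lt_pair_left b h)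

theorem evalCode_code {A : Type} [Encodable A] (L : List ℕ) (f : BForm A) :
    evalCode L f.code = f.eval fun a => decide (encode a ∈ L) := by
  induction f with
  | tru => simp [evalCode, evalStep, length_evalTable, BForm.code, BForm.eval]
  | fls => simp [evalCode, evalStep, length_evalTable, BForm.code, BForm.eval]
  | atom a => simp [evalCode, evalStep, length_evalTable, BForm.code, BForm.eval]
  | neg f ih =>
    rw [evalCode, evalStep, length_evalTable]
    simp only [BForm.code, Nat.unpair_pair, BForm.eval]
    rw [getD_evalTable L (lt_pair_of_pos _ (by norm_num)), ih]
    simp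
  | and f g ihf ihg =>
    rw [evalCode, evalStep, length_evalTable]
    simp only [BForm.code, Nat.unpair_pair, BForm.eval]
    rw [getD_evalTable L ((Nat.left_le_pair _ _).trans_lt (lt_pair_of_pos _ (by norm_num))),
      getD_evalTable L ((Nat.right_le_pair _ _).trans_lt (lt_pair_of_pos _ (by norm_num))),
      ihf, ihg]
    simp
  | or f g ihf ihg =>
    rw [evalCode, evalStep, length_evalTable]
    simp only [BForm.code, Nat.unpair_pair, BForm.eval]
    rw [getD_evalTable L ((Nat.left_le_pair _ _).trans_lt (lt_pair_of_pos _ (by norm_num))),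
      getD_evalTable L ((Nat.right_le_pair _ _).trans_lt (lt_pair_of_pos _ (by norm_num))),
      ihf, ihg]
    simp

/-! ### Bit vectors given by lists -/

/-- The bit vector in which the bits with codes in `S` are set. -/
def bitsOf (B : Type) [Encodable B] (S : List ℕ) : B → Bool := fun b => decide (encode b ∈ S)

/-- The codes, below `n`, of the bits that are set in `b`. -/
noncomputable def codesOf {B : Type} [Encodable B] (n : ℕ) (b : B → Bool) : List ℕ := by
  classical exact (List.range n).filter fun c => decide (∃ a, encode a = c ∧ b a = true)

theorem bitsOf_codesOf {B : Type} [Encodable B] {n : ℕ} (h : ∀ a : B, encode a < n)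
    (b : B → Bool) : bitsOf B (codesOf n b) = b := by
  funext a
  rw [bitsOf, Bool.eq_iff_iff, decide_eq_true_iff]
  simp only [codesOf, List.mem_filter, List.mem_range, h a, true_and, decide_eq_true_eq]
  constructor
  · rintro ⟨a', ha', hb⟩
    rwa [← encode_injective ha']
  · exact fun hb => ⟨a, rfl, hb⟩

theorem codesOf_mem {B : Type} [Encodable B] (n : ℕ) (b : B → Bool) :
    codesOf n b ∈ listsUpTo n (List.range n) := by
  rw [mem_listsUpTo]
  refine ⟨(List.length_filter_le _ _).trans (List.length_range).le, fun a ha => ?_⟩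
  exact List.mem_of_mem_filter ha

/-! ### Automata given by codes -/

/-- Codes of automata: the number of states, the codes of the transition formulae, of the initial
and of the final formula. -/
abbrev AutData : Type := ℕ × List ℕ × ℕ × ℕ

/-- The data encoded by the code of an automaton. -/
def AFA.data {B P : Type} [Encodable B] [Encodable P] (A : AFA B P) : AutData :=
  (A.states, List.ofFn (fun q => (A.trans q).code), A.init.code, A.final.code)

/-- The step relation on configurations given as lists of states. -/
def StepData (a : AutData) (C S D : List ℕ) : Prop :=
  ∀ q ∈ C, evalCode (S.map (fun x => 2 * x) ++ D.map fun x => 2 * x + 1) (a.2.1.getD q 0) = true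

instance (a : AutData) (C S D : List ℕ) : Decidable (StepData a C S D) := by
  unfold StepData; infer_instance

/-- Candidates for configurations. -/
def configs (a : AutData) : List (List ℕ) := listsUpTo a.1 (List.range a.1)

/-- Configurations reachable by a run over a word from a list of configurations. -/
def reachable (a : AutData) (w l : List (List ℕ)) : List (List ℕ) :=
  w.foldl (fun l S => (configs a).filter fun D => decide (∃ C ∈ l, StepData a C S D)) l

/-- Acceptance of a word. -/
def AcceptsData (a : AutData) (w : List (List ℕ)) : Prop :=
  ∃ D ∈ reachable a w ((configs a).filter fun C =>
    decide (evalCode (C.map fun x => 2 * x) a.2.2.1 = true)),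
    evalCode (D.map fun x => 2 * x) a.2.2.2 = true

@[fun_prop]
theorem primrecPred_acceptsData {α : Type} [Primcodable α] {f : α → AutData}
    {g : α → List (List ℕ)} (hf : Primrec f) (hg : Primrec g) :
    PrimrecPred fun a => AcceptsData (f a) (g a) := by
  unfold AcceptsData reachable configs StepData
  fun_prop

/-- In a sum type, left summands have even codes and right ones odd codes. Listing even codes only
sets every parameter to false. -/
theorem evalCode_map_code {P : Type} [Encodable P] {n : ℕ} (f : BForm (Fin n ⊕ P)) (C : List ℕ) :
    evalCode (C.map fun x => 2 * x) f.code =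
      f.eval (Sum.elim (bitsOf (Fin n) C) fun _ => false) := by
  rw [evalCode_code]
  congr 1
  funext a
  rw [Bool.eq_iff_iff]
  rcases a with q | p
  · simp only [encode_inl, List.mem_map, decide_eq_true_eq, Sum.elim_inl, bitsOf]
    constructor
    · rintro ⟨x, hx, he⟩
      rwa [← Nat.eq_of_mul_eq_mul_left two_pos he]
    · exact fun h => ⟨_, h, rfl⟩
  · simp only [encode_inr, List.mem_map, decide_eq_true_eq, Sum.elim_inr, Bool.false_eq_true,
      iff_false, not_exists, not_and]
    intro x _
    omega

section

variable {B P : Type} [Encodable B] [Encodable P] (A : AFA B P)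

theorem stepData_iff (C S D : List ℕ) :
    StepData A.data C S D ↔ A.Step (bitsOf _ C) (bitsOf B S) (bitsOf _ D) := by
  have hev : ∀ q, evalCode (S.map (fun x => 2 * x) ++ D.map fun x => 2 * x + 1) (A.trans q).code =
      (A.trans q).eval (Sum.elim (bitsOf B S) (bitsOf _ D)) := by
    intro q
    rw [evalCode_code]
    congr 1
    funext a
    rw [Bool.eq_iff_iff]
    rcases a with b | r
    · simp only [encode_inl, List.mem_append, List.mem_map, decide_eq_true_eq, Sum.elim_inl, bitsOf]
      constructor
      · rintro (⟨x, hx, he⟩ | ⟨x, hx, he⟩)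
        · rwa [← Nat.eq_of_mul_eq_mul_left two_pos he]
        · omega
      · exact fun h => .inl ⟨_, h, rfl⟩
    · simp only [encode_inr, List.mem_append, List.mem_map, decide_eq_true_eq, Sum.elim_inr, bitsOf]
      constructor
      · rintro (⟨x, hx, he⟩ | ⟨x, hx, he⟩)
        · omega
        · rwa [← show x = encode r by omega]
      · exact fun h => .inr ⟨_, h, rfl⟩
  constructor
  · intro h q hq
    have h1 := h q.1 (of_decide_eq_true hq)
    rw [← hev]
    have h2 : A.data.2.1.getD q.1 0 = (A.trans q).code := by
      simp [AFA.data]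
    rwa [h2] at h1
  · intro h q hq
    by_cases hlt : q < A.states
    · have h2 : A.data.2.1.getD q 0 = (A.trans ⟨q, hlt⟩).code := by
        simp [AFA.data, hlt]
      rw [h2, hev]
      exact h ⟨q, hlt⟩ (decide_eq_true hq)
    -- The default value 0 is the code of the true formula, so entries of `C` that are not states
    -- impose no condition.
    · have h2 : A.data.2.1.getD q 0 = (BForm.tru : BForm ℕ).code := by
        simp [AFA.data, hlt, BForm.code, Nat.pair]
      rw [h2, evalCode_code]
      rfl

theorem exists_mem_configs (α : A.Config) : ∃ C ∈ configs A.data, bitsOf _ C = α :=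
  ⟨codesOf A.states α, codesOf_mem _ _, bitsOf_codesOf (fun a => a.2) α⟩

theorem exists_mem_reachable_iff (w l : List (List ℕ)) (β : A.Config) :
    (∃ D ∈ reachable A.data w l, bitsOf _ D = β) ↔
      ∃ C ∈ l, A.Run (bitsOf _ C) (w.map (bitsOf B)) β := by
  induction w generalizing l with
  | nil => rfl
  | cons S w ih =>
    rw [reachable, List.foldl_cons, ← reachable, ih]
    simp only [List.mem_filter, decide_eq_true_eq, stepData_iff, List.map_cons, AFA.Run]
    constructor
    · rintro ⟨D, ⟨-, C, hC, hs⟩, hr⟩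
      exact ⟨C, hC, _, hs, hr⟩
    · rintro ⟨C, hC, γ, hs, hr⟩
      obtain ⟨D, hD, rfl⟩ := exists_mem_configs A γ
      exact ⟨D, ⟨hD, C, hC, hs⟩, hr⟩

theorem acceptsData_iff (w : List (List ℕ)) :
    AcceptsData A.data w ↔ A.Accepts (fun _ => false) (w.map (bitsOf B)) := by
  have hl : ∀ C, C ∈ ((configs A.data).filter fun C =>
      decide (evalCode (C.map fun x => 2 * x) A.data.2.2.1 = true)) ↔ C ∈ configs A.data ∧
        A.init.eval (Sum.elim (bitsOf (Fin A.states) C) fun _ => false) = true := fun C => by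
    rw [List.mem_filter, decide_eq_true_iff, ← evalCode_map_code]
    rfl
  have hf : ∀ D, evalCode (D.map fun x => 2 * x) A.data.2.2.2 =
      A.final.eval (Sum.elim (bitsOf (Fin A.states) D) fun _ => false) := fun D =>
    evalCode_map_code _ _
  rw [AcceptsData]
  have h := exists_mem_reachable_iff A w ((configs A.data).filter fun C =>
    decide (evalCode (C.map fun x => 2 * x) A.data.2.2.1 = true))
  simp only [hf]
  constructor
  · rintro ⟨D, hD, hf⟩
    obtain ⟨C, hC, hr⟩ := (h _).1 ⟨D, hD, rfl⟩
    exact ⟨_, _, hr, ((hl C).1 hC).2, hf⟩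
  · rintro ⟨α, β, hr, hi, hf⟩
    obtain ⟨C, hC, rfl⟩ := exists_mem_configs A α
    obtain ⟨D, hD, rfl⟩ := (h β).2 ⟨C, (hl C).2 ⟨hC, hi⟩, hr⟩
    exact ⟨D, hD, hf⟩

end

end StringSL

namespace StringSL

open Encodable

/-! ### Conjunctions given by codes -/

/-- Codes dominate the codes of their components. Hence the code of a conjunction can itself serve
as the size bound `N` for its variables, states and lengths. -/
theorem encode_lt_of_mem {α : Type} [Encodable α] {a : α} {l : List α} (h : a ∈ l) :
    encode a < encode l := by
  induction l with
  | nil => simp at h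
  | cons b l ih =>
    rw [encode_list_cons, Nat.lt_succ_iff]
    rcases List.mem_cons.1 h with rfl | h
    · exact Nat.left_le_pair _ _
    · exact (ih h).le.trans (Nat.right_le_pair _ _)

theorem length_le_encode {α : Type} [Encodable α] (l : List α) : l.length ≤ encode l := by
  induction l with
  | nil => simp
  | cons a l ih =>
    rw [encode_list_cons, List.length_cons]
    exact Nat.succ_le_succ (ih.trans (Nat.right_le_pair _ _))

/-- Contents of a track without the erased letters. -/
def trackData (k e i : ℕ) (w : List (List ℕ)) : Word k :=
  w.filterMap fun S => if ∃ j ∈ List.range e, Nat.pair (2 * j + 1) i ∈ S then none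
    else some fun v : Fin k => decide (Nat.pair (2 * v) i ∈ S)

theorem trackData_eq (k e : ℕ) (i : Fin 2) (w : List (List ℕ)) :
    trackData k e i w = compact (track i (w.map (bitsOf ((Fin k ⊕ Fin e) × Fin 2)))) := by
  rw [trackData, compact, track, List.map_map, List.filterMap_map]
  congr 1
  funext S
  have h : (∃ j ∈ List.range e, Nat.pair (2 * j + 1) i ∈ S) ↔
      ∃ j : Fin e, bitsOf ((Fin k ⊕ Fin e) × Fin 2) S (Sum.inr j, i) = true := by
    simp only [bitsOf, decide_eq_true_eq, List.mem_range]
    exact ⟨fun ⟨j, hj, hS⟩ => ⟨⟨j, hj⟩, hS⟩, fun ⟨j, hS⟩ => ⟨j, j.2, hS⟩⟩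
  simp only [Function.comp_apply, h]
  rfl

section Primrec

variable {α : Type} [Primcodable α] {k : ℕ}

@[fun_prop]
theorem primrec_finFun {n : ℕ} {σ : Type} [Primcodable σ] {f : α → Fin n → σ}
    (h : Primrec fun x : α × Fin n => f x.1 x.2) : Primrec fun a => (fun v => f a v) :=
  Primrec.fin_curry.2 h

@[fun_prop]
theorem primrec_finVal {n : ℕ} {f : α → Fin n} (hf : Primrec f) :
    Primrec fun a => (f a : ℕ) := Primrec.fin_val.comp hf

@[fun_prop]
theorem primrec_trackData {f g : α → ℕ} {h : α → List (List ℕ)} (hf : Primrec f)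
    (hg : Primrec g) (hh : Primrec h) : Primrec fun a => trackData k (f a) (g a) (h a) := by
  unfold trackData
  refine primrec_filterMap hh (primrec_ite (by fun_prop) (by fun_prop) (primrec_some ?_))
  refine primrec_finFun ?_
  fun_prop

-- Although `codesOf` is defined classically, it has a finite domain here, and every function on a
-- finite domain is primitive recursive.
@[fun_prop]
theorem primrec_codesOf {f : α → Letter k} (hf : Primrec f) :
    Primrec fun a => codesOf k (f a) := (Primrec.dom_finite _).comp hf

end Primrec

/-- Satisfaction of a regular literal. -/
def RegData {k : ℕ} (σ : List (Word k)) (d : Bool × AutData × ℕ) : Prop :=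
  (d.1 = true ∧ ¬ AcceptsData d.2.1 ((σ.getD d.2.2 []).map fun b => codesOf k b)) ∨
    (d.1 = false ∧ AcceptsData d.2.1 ((σ.getD d.2.2 []).map fun b => codesOf k b))

/-- Satisfaction of a conjunct with witnesses of length at most `b` over letters with bit codes
below `N`. -/
def ConjunctData {k : ℕ} (b N : ℕ) (σ : List (Word k)) (c : ℕ) : Prop :=
  (c.unpair.1 = 0 ∧ σ.getD (decodeD (ℕ × List ℕ) c.unpair.2).1 [] =
    (decodeD (ℕ × List ℕ) c.unpair.2).2.flatMap fun z => σ.getD z []) ∨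
  (c.unpair.1 = 1 ∧ ∃ w ∈ listsUpTo b (listsUpTo N (List.range N)),
    AcceptsData (decodeD (ℕ × (ℕ × AutData) × List ℕ) c.unpair.2).2.1.2 w ∧
    σ.getD (decodeD (ℕ × (ℕ × AutData) × List ℕ) c.unpair.2).1 [] =
      trackData k (decodeD (ℕ × (ℕ × AutData) × List ℕ) c.unpair.2).2.1.1 0 w ∧
    (decodeD (ℕ × (ℕ × AutData) × List ℕ) c.unpair.2).2.2.flatMap (fun z => σ.getD z []) =
      trackData k (decodeD (ℕ × (ℕ × AutData) × List ℕ) c.unpair.2).2.1.1 1 w)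

/-- Satisfiability of the straight-line conjunction with code `n`, by bounded search. -/
def SatData (k n : ℕ) : Prop :=
  ∃ σ ∈ listsUpTo (n + 1) (listsUpTo (solutionBound n) (Finset.univ : Finset (Letter k)).toList),
    (∀ c ∈ (decodeD (List ℕ × List ℕ) n).1, RegData σ (decodeD (Bool × AutData × ℕ) c)) ∧
    ∀ c ∈ (decodeD (List ℕ × List ℕ) n).2,
      ConjunctData (solutionBound n) ((2 * (k + n) + 3) ^ 2) σ c

theorem primrecPred_satData (k : ℕ) : PrimrecPred (SatData k) := by
  unfold SatData RegData ConjunctData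
  fun_prop

theorem RegLit.decodeD_code {k : ℕ} (c : RegLit k) :
    decodeD (Bool × AutData × ℕ) c.code = (c.neg, c.aut.data, c.var) :=
  decodeD_encode (c.neg, c.aut.data, c.var)

theorem map_bitsOf_codesOf {k : ℕ} (w : Word k) :
    (w.map fun b => codesOf k b).map (bitsOf (Fin k)) = w := by
  rw [List.map_map]
  exact (List.map_congr_left fun b _ => bitsOf_codesOf (fun a => a.2) b).trans (List.map_id w)

theorem RegLit.regData_iff {k : ℕ} (c : RegLit k) (σ : List (Word k)) :
    RegData σ (decodeD _ c.code) ↔ c.Holds fun z => σ.getD z [] := by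
  rw [c.decodeD_code, RegData, RegLit.Holds]
  simp only [acceptsData_iff, map_bitsOf_codesOf,
    Subsingleton.elim (fun _ : Empty => false) Empty.elim]
  cases c.neg <;> simp

theorem AFA.exists_word_of_accepts {B P : Type} [Encodable B] [Encodable P] (A : AFA B P) {N : ℕ}
    (hN : ∀ a : B, encode a < N) (b : ℕ) (p : List (B → Bool) → Prop) :
    (∃ w ∈ listsUpTo b (listsUpTo N (List.range N)), AcceptsData A.data w ∧
        p (w.map (bitsOf B))) ↔
      ∃ w, w.length ≤ b ∧ A.Accepts (fun _ => false) w ∧ p w := by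
  constructor
  · rintro ⟨w, hw, ha, hp⟩
    exact ⟨_, by simpa using (mem_listsUpTo.1 hw).1, (acceptsData_iff A w).1 ha, hp⟩
  · rintro ⟨w, hw, ha, hp⟩
    have h : (w.map (codesOf N)).map (bitsOf B) = w := by
      rw [List.map_map]
      exact (List.map_congr_left fun b _ => bitsOf_codesOf hN b).trans (List.map_id w)
    refine ⟨w.map (codesOf N), mem_listsUpTo.2 ⟨by simpa using hw, ?_⟩, ?_, ?_⟩
    · simp only [List.forall_mem_map]
      exact fun b _ => codesOf_mem N b
    · rwa [acceptsData_iff, h]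
    · rwa [h]

theorem Conjunct.conjunctData_iff {k N : ℕ} (b : ℕ) (σ : List (Word k)) (c : Conjunct k)
    (hN : ∀ x R ys, c = rat x R ys → ∀ a : (Fin k ⊕ Fin R.eps) × Fin 2, encode a < N) :
    ConjunctData b N σ c.code ↔ c.HoldsWithin b (fun z => σ.getD z []) fun _ => false := by
  cases c with
  | eqn x ys =>
    have h : decodeD (ℕ × List ℕ) (Encodable.encode (x, ys)) = (x, ys) := decodeD_encode _
    simp only [ConjunctData, code, Nat.unpair_pair, h, true_and, zero_ne_one, false_and, or_false,
      HoldsWithin]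
  | rat x R ys =>
    have h : decodeD (ℕ × (ℕ × AutData) × List ℕ) (Encodable.encode (x, R.code, ys)) =
        (x, (R.eps, R.aut.data), ys) := decodeD_encode (x, (R.eps, R.aut.data), ys)
    simp only [ConjunctData, code, Nat.unpair_pair, h, one_ne_zero, false_and, false_or, true_and]
    have h₀ := trackData_eq k R.eps 0
    have h₁ := trackData_eq k R.eps 1
    simp only [Fin.val_zero, Fin.val_one] at h₀ h₁
    simp only [h₀, h₁]
    exact R.aut.exists_word_of_accepts (hN x R ys rfl) b fun w =>
      σ.getD x [] = compact (track 0 w) ∧ (ys.flatMap fun z => σ.getD z []) = compact (track 1 w)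

theorem RegLit.states_le_code {k : ℕ} (c : RegLit k) : c.aut.states ≤ c.code :=
  ((Nat.left_le_pair _ _).trans (Nat.left_le_pair _ _)).trans (Nat.right_le_pair _ _)

theorem RegLit.var_le_code {k : ℕ} (c : RegLit k) : c.var ≤ c.code :=
  (Nat.right_le_pair _ _).trans (Nat.right_le_pair _ _)

namespace Conjunct

variable {k : ℕ}

theorem hasVar_le_code {c : Conjunct k} {z : ℕ} (h : c.HasVar z) : z ≤ c.code := by
  cases c with
  | eqn x ys =>
    refine le_trans ?_ (Nat.right_le_pair _ _)
    rcases h with rfl | h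
    · exact Nat.left_le_pair _ _
    · exact (encode_lt_of_mem h).le.trans (Nat.right_le_pair _ _)
  | rat x R ys =>
    refine le_trans ?_ (Nat.right_le_pair _ _)
    rcases h with rfl | h
    · exact Nat.left_le_pair _ _
    · exact ((encode_lt_of_mem h).le.trans (Nat.right_le_pair _ _)).trans (Nat.right_le_pair _ _)

theorem code_le_of_rat (x : ℕ) (R : AFT k 2) (ys : List ℕ) :
    R.code ≤ (rat x R ys).code :=
  ((Nat.left_le_pair _ _).trans (Nat.right_le_pair _ _)).trans (Nat.right_le_pair _ _)

theorem length_le_of_eqn (x : ℕ) (ys : List ℕ) : ys.length ≤ (eqn x ys : Conjunct k).code :=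
  ((length_le_encode ys).trans (Nat.right_le_pair _ _)).trans (Nat.right_le_pair _ _)

end Conjunct

theorem AFT.eps_le_code {k n : ℕ} (R : AFT k n) : R.eps ≤ R.code := Nat.left_le_pair _ _

theorem AFT.states_le_code {k n : ℕ} (R : AFT k n) : R.aut.states ≤ R.code :=
  (Nat.left_le_pair _ _).trans (Nat.right_le_pair _ _)

/-- Input bits have codes `2 * v`, epsilon bits `2 * j + 1`, and a pairing lies below the square of
the larger component plus one. -/
theorem encode_bit_lt {k e n : ℕ} (he : e ≤ n) (a : (Fin k ⊕ Fin e) × Fin 2) :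
    encode a < (2 * (k + n) + 3) ^ 2 := by
  obtain ⟨a, i⟩ := a
  refine (Nat.pair_lt_max_add_one_sq (encode a) (encode i)).trans_le ?_
  refine Nat.pow_le_pow_left ?_ 2
  have h1 : encode a ≤ 2 * (k + n) + 2 := by
    rcases a with v | j
    · have : encode (Sum.inl v : Fin k ⊕ Fin e) = 2 * v := rfl
      omega
    · have : encode (Sum.inr j : Fin k ⊕ Fin e) = 2 * j + 1 := rfl
      omega
  have h2 : encode i ≤ 2 * (k + n) + 2 := by
    have : encode i = i := rfl
    omega
  have := max_le h1 h2
  omega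

theorem SLConj.satData_iff {k : ℕ} (φ : SLConj k) : SatData k φ.code ↔ φ.Satisfiable := by
  set n := φ.code with hn
  have hdec : decodeD (List ℕ × List ℕ) n = (φ.regs.map RegLit.code, φ.defs.map Conjunct.code) :=
    decodeD_encode (φ.regs.map RegLit.code, φ.defs.map Conjunct.code)
  have hregs : encode (φ.regs.map RegLit.code) ≤ n := Nat.left_le_pair _ _
  have hdefs : encode (φ.defs.map Conjunct.code) ≤ n := Nat.right_le_pair _ _
  have hr : ∀ c ∈ φ.regs, c.code ≤ n := fun c hc =>
    (encode_lt_of_mem (List.mem_map_of_mem (f := RegLit.code) hc)).le.trans hregs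
  have hd : ∀ c ∈ φ.defs, c.code ≤ n := fun c hc =>
    (encode_lt_of_mem (List.mem_map_of_mem (f := Conjunct.code) hc)).le.trans hdefs
  have hsize : ∀ c ∈ φ.defs, c.SizeLe n := by
    intro c hc
    cases c with
    | eqn x ys => exact (Conjunct.length_le_of_eqn x ys).trans (hd _ hc)
    | rat x R ys =>
      exact ⟨(R.states_le_code.trans (Conjunct.code_le_of_rat x R ys)).trans (hd _ hc),
        (φ.isSL.2 x R ys hc).2⟩
  have hbit : ∀ c ∈ φ.defs, ∀ x R ys, c = Conjunct.rat x R ys →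
      ∀ a : (Fin k ⊕ Fin R.eps) × Fin 2, encode a < (2 * (k + n) + 3) ^ 2 := by
    rintro _ hc x R ys rfl
    exact encode_bit_lt ((R.eps_le_code.trans (Conjunct.code_le_of_rat x R ys)).trans (hd _ hc))
  have hiff : SatData k n ↔ ∃ σ : List (Word k), (σ.length ≤ n + 1 ∧
      ∀ w ∈ σ, w.length ≤ solutionBound n) ∧ (∀ c ∈ φ.regs, c.Holds fun z => σ.getD z []) ∧
      ∀ c ∈ φ.defs, c.HoldsWithin (solutionBound n) (fun z => σ.getD z []) fun _ => false := by
    rw [SatData, hdec]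
    refine exists_congr fun σ => and_congr ?_ (and_congr ?_ ?_)
    · simp [mem_listsUpTo]
    · simp only [List.forall_mem_map, RegLit.regData_iff]
    · rw [List.forall_mem_map]
      exact forall₂_congr fun c hc => c.conjunctData_iff _ σ (hbit c hc)
  rw [hiff, φ.satisfiable_iff_bounded (fun c hc => c.states_le_code.trans (hr c hc))
    (by simpa using (length_le_encode (φ.regs.map RegLit.code)).trans hregs) hsize
    (by simpa using (length_le_encode (φ.defs.map Conjunct.code)).trans hdefs)]
  constructor
  · rintro ⟨σ, ⟨-, hσ⟩, h₁, h₂⟩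
    refine ⟨fun z => σ.getD z [], fun z => ?_, h₁, h₂⟩
    change (σ.getD z []).length ≤ _
    by_cases hz : z < σ.length
    · rw [List.getD_eq_getElem _ _ hz]
      exact hσ _ (List.getElem_mem hz)
    · rw [List.getD_eq_default _ _ (not_lt.1 hz)]
      exact Nat.zero_le _
  · rintro ⟨ι, hι, h₁, h₂⟩
    -- All variables of the conjunction are at most `n`, so a table of `n + 1` words determines the
    -- solution; other variables default to the empty word.
    have hget : ∀ z ≤ n, ι z = ((List.range (n + 1)).map ι).getD z [] := by
      intro z hz
      rw [List.getD_eq_getElem _ _ (by simp; omega)]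
      simp
    refine ⟨(List.range (n + 1)).map ι, ⟨by simp, ?_⟩, fun c hc => ?_, fun c hc => ?_⟩
    · simp only [List.forall_mem_map]
      exact fun z _ => hι z
    · have := h₁ c hc
      simpa only [RegLit.Holds, hget c.var (c.var_le_code.trans (hr c hc))] using this
    · exact (h₂ c hc).mono le_rfl fun z hz => hget z ((Conjunct.hasVar_le_code hz).trans (hd c hc))

theorem exists_computable_satisfiable (k : ℕ) :
    ∃ f : ℕ → Bool, Computable f ∧ ∀ φ : SLConj k, f φ.code = true ↔ φ.Satisfiable := by
  obtain ⟨_, h⟩ := primrecPred_satData k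
  exact ⟨_, h.to_comp, fun φ => by rw [decide_eq_true_iff, φ.satData_iff]⟩

end StringSL

theorem mainTheorem3 (k : ℕ) :
    (∀ φ₀ : StringSL.Conj k, StringSL.Conj.IsSL φ₀ →
      -- substitution, splitting and reordering can be carried out to the end, in any order
      (Acc (fun b a => StringSL.Conj.SubstStep a b) φ₀ ∧
        (∀ φ₁, StringSL.Conj.Substituted φ₀ φ₁ →
          Acc (fun b a => StringSL.Conj.SplitStep a b) φ₁ ∧
          ∀ φ₂, StringSL.Conj.Splitted φ₁ φ₂ → ∃ φ₃, StringSL.Conj.Reorder φ₂ φ₃) ∧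
        ∃ φ₃, StringSL.Conj.Translates φ₀ φ₃) ∧
      -- every result is equisatisfiable and acyclic
      (∀ φ₃, StringSL.Conj.Translates φ₀ φ₃ →
        (φ₃.Satisfiable ↔ StringSL.Conj.Satisfiable φ₀) ∧ φ₃.Acyclic)) ∧
    -- satisfiability of straight-line conjunctions is decidable
    (∃ f : ℕ → Bool, Computable f ∧
      ∀ φ : StringSL.SLConj k, f φ.code = true ↔ φ.Satisfiable) := by
  refine ⟨fun φ₀ hφ₀ => ?_, StringSL.exists_computable_satisfiable k⟩
  obtain ⟨rank, sz, h₀⟩ := hφ₀.1.exists_ranked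
  have hsplit : ∀ φ₁, StringSL.Conj.Substituted φ₀ φ₁ →
      Acc (fun b a => StringSL.Conj.SplitStep a b) φ₁ ∧
      ∀ φ₂, StringSL.Conj.Splitted φ₁ φ₂ → ∃ φ₃, StringSL.Conj.Reorder φ₂ φ₃ := by
    intro φ₁ h₁
    have hr₁ := (h₀.substSteps h₁.1).1
    refine ⟨hr₁.acc_splitStep, fun φ₂ h₂ => ?_⟩
    obtain ⟨⟨_, _, hr₂⟩, hrat, -⟩ := hr₁.splitSteps h₁.2 h₂.1
    exact hr₂.exists_reorder hrat h₂.2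
  refine ⟨⟨StringSL.Conj.acc_substStep φ₀, hsplit, ?_⟩, ?_⟩
  · obtain ⟨φ₁, h₁⟩ := StringSL.Conj.exists_substituted φ₀
    obtain ⟨φ₂, h₂⟩ := StringSL.Conj.exists_splitted (hsplit φ₁ h₁).1 h₁.2
    obtain ⟨φ₃, h₃⟩ := (hsplit φ₁ h₁).2 φ₂ h₂
    exact ⟨φ₃, φ₁, φ₂, h₁, h₂, h₃⟩
  · rintro φ₃ ⟨φ₁, φ₂, h₁, h₂, h₃⟩
    obtain ⟨hr₁, hs₁⟩ := h₀.substSteps h₁.1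
    obtain ⟨-, -, hs₂⟩ := hr₁.splitSteps h₁.2 h₂.1
    exact ⟨h₃.satisfiable_iff.trans (hs₂.trans hs₁), h₃.acyclic⟩
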